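/- Let $(\mathcal A,\varphi)$ be a noncommutative probability space, i.e. $\mathcal A$ is a unital associative algebra over $\mathbb C$ and $\varphi\colon\mathcal A\to\mathbb C$ is linear with $\varphi(1_{\mathcal A})=1$. Put $\varphi_n(a_1,\dots,a_n)=\varphi(a_1\cdots a_n)$. For a family of functionals $f_n\colon\mathcal A^n\to\mathbb C$ and a noncrossing partition $\pi\in\operatorname{NC}(n)$ of $\{1,\dots,n\}$ put $f_\pi(a_1,\dots,a_n)=\prod_{V\in\pi}f_{|V|}(a_{i_1},\dots,a_{i_s})$, where $V=\{i_1<\dots<i_s\}$. Let $\{h_n\colon\mathcal A^n\to\mathbb C\}_{n\ge1}$ be the monotone cumulants, i.e. the multilinear functionals determined recursively by $$\varphi_n(a_1,\dots,a_n)=\sum_{\pi\in\operatorname{NC}(n)}\frac1{t(\pi)!}\,h_\pi(a_1,\dots,a_n)\qquad(n\ge1),$$ where $t(\pi)$ is the forest of nestings of $\pi$ (its vertices are the blocks of $\pi$; $W$ is a child of $V$ if $V$ covers $W$ in the order $V\le W\iff W\subseteq[\min V,\max V]$), and the factorial of a forest is the product of the factorials of its trees, with $t!=|t|\,s_1!\cdots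 s_m!$ for the tree $t$ with $|t|$ vertices obtained by grafting $s_1,\dots,s_m$ to a root. Let $\operatorname{ST}(n)$ be the set of Schröder trees with $n+1$ leaves, i.e. planar rooted trees in which every internal vertex has at least two children. For $t\in\operatorname{ST}(n)$ label the $n$ sectors between consecutive leaves by $1,\dots,n$ from left to right, and let $\pi(t)\in\operatorname{NC}(n)$ be the partition whose blocks are, for the internal vertices $v$ of $t$, the sets of labels of the sectors lying between consecutive children of $v$. For $n\ge1$ let $\operatorname{sk}(t)$ be the planar rooted tree formed by the internal vertices of $t$. For a rooted tree $s$ with $|s|$ vertices, ordered so that the root is minimal, let $\omega_k(s)$ be the number of surjections $f\colon s\to\{1,\dots,k\}$ with $f(v)<f(w)$ whenever $v<w$, and let $\omega(s)=\sum_{k=1}^{|s|}\frac{(-1)^{k+1}}k\,\omega_k(s)$. Then for all $n\ge1$ and $a_1,\dots,a_n\in\mathcal A$, $$h_n(a_1,\dots,a_n)=\sum_{\pi\in\operatorname{NC}(n)}\alpha(\pi)\,\varphi_\pi(a_1,\dots,a_n),\qquad \alpha(\pi)=\sum_{\substack{t\in\operatorname{ST}(n)\\ \pi(t)=\pi}}\omega(\operatorname{sk}(t)).$$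 -/

import Mathlib

open Finset

namespace NCProb

/-! ### Planar rooted trees -/

/-- A planar rooted tree: a root together with the (left to right) list of the subtrees
grafted to it. -/
inductive PlanarTree : Type
  | node : List PlanarTree → PlanarTree

namespace PlanarTree

/-- The subtrees rooted at the children of the root, from left to right. -/
def children : PlanarTree → List PlanarTree
  | node ts => ts

/-- The number of vertices `|t|`. -/
def size : PlanarTree → ℕ
  | node ts => 1 + (ts.map size).sum

/-- The number of leaves, a leaf being a vertex without children. -/
def numLeaves : PlanarTree → ℕ
  | node ts => if ts.isEmpty then 1 else (ts.map numLeaves).sum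

/-- The tree factorial: `t! = |t| * s₁! * ⋯ * sₘ!` for `t = [s₁, …, sₘ]`
(so `t! = 1` if `t` is a single vertex). -/
def factorial : PlanarTree → ℕ
  | node ts => size (node ts) * (ts.map factorial).prod

/-- The vertices of a tree, each one named by its address: the list of the (zero-based) child
indices met on the path from the root to the vertex. -/
def vertexList : PlanarTree → List (List ℕ)
  | node ts => [] :: ((ts.map vertexList).mapIdx fun i l => l.map (i :: ·)).flatten

/-- The set of vertices of a tree, as addresses. The tree order `v ≤ w` (that is, `v` lies on the
path from the root to `w`) is the relation "`v` is a prefix of `w`". -/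
def vertices (t : PlanarTree) : Finset (List ℕ) := t.vertexList.toFinset

/-- A Schröder tree: a planar rooted tree all of whose internal vertices have at least two
children. -/
inductive IsSchroeder : PlanarTree → Prop
  | leaf : IsSchroeder (node [])
  | branch (ts : List PlanarTree) (two_le : 2 ≤ ts.length) (h : ∀ t ∈ ts, IsSchroeder t) :
      IsSchroeder (node ts)

/-- The skeleton of a tree: the planar tree formed by the internal vertices, all leaves being
erased. (Only meaningful if the root itself is an internal vertex.) -/
def skeleton : PlanarTree → PlanarTree
  | node ts => node ((ts.filter fun s => !s.children.isEmpty).map skeleton)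

/-- The sectors of a tree with leaves `0, …, n` are the `n` gaps between consecutive leaves.
This is the list, from left to right, of the internal vertices (as addresses) to whose corolla
the sectors belong: the gap between two consecutive subtrees of a vertex `v` is a sector
of the corolla with root `v`. -/
def sectorList : PlanarTree → List (List ℕ)
  | node ts => List.intercalate [[]] ((ts.map sectorList).mapIdx fun i l => l.map (i :: ·))

/-- The number `ω_k(t)` of surjective maps `f` from the vertices of `t` to a chain with `k`
elements such that `f v < f w` whenever `v < w` in the tree order. -/
noncomputable def omegaCount (t : PlanarTree) (k : ℕ) : ℕ :=
  Nat.card {f : t.vertices → Fin k // Function.Surjective f ∧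
    ∀ v w : t.vertices, v.1 <+: w.1 → v ≠ w → f v < f w}

/-- The Murua coefficient `ω(t) = ∑_{k=1}^{|t|} (-1)^(k+1) / k * ω_k(t)`. -/
noncomputable def murua (t : PlanarTree) : ℚ :=
  ∑ k ∈ Finset.Icc 1 t.size, (-1) ^ (k + 1) / (k : ℚ) * (t.omegaCount k : ℚ)

end PlanarTree

/-! ### Noncrossing partitions -/

/-- Set partitions of `{0, …, n-1}`. -/
abbrev SetPartition (n : ℕ) : Type := Finpartition (Finset.univ : Finset (Fin n))

/-- There are no `a < b < c < d` with `a, c` in one block and `b, d` in another block. -/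
def IsNoncrossing {n : ℕ} (π : SetPartition n) : Prop :=
  ∀ V ∈ π.parts, ∀ W ∈ π.parts, ∀ a b c d : Fin n, a < b → b < c → c < d →
    a ∈ V → c ∈ V → b ∈ W → d ∈ W → V = W

open Classical in
/-- The noncrossing partitions `NC(n)`. -/
noncomputable def NC (n : ℕ) : Finset (SetPartition n) := Finset.univ.filter IsNoncrossing

section Nesting

variable {n : ℕ}

/-- `V ≤ W` in the nesting order: `W` is contained in the interval `[min V, max V]`. -/
def Nests (V W : Finset (Fin n)) : Prop :=
  ∀ a ∈ W, (∃ x ∈ V, x ≤ a) ∧ ∃ y ∈ V, a ≤ y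

/-- The strict nesting order `V < W`. -/
def StrictNests (V W : Finset (Fin n)) : Prop := Nests V W ∧ V ≠ W

/-- `V` covers `W` in `π`: `V < W` and there is no block `U` with `V < U < W`. -/
def Covers (π : SetPartition n) (V W : Finset (Fin n)) : Prop :=
  StrictNests V W ∧ ∀ U ∈ π.parts, ¬ (StrictNests V U ∧ StrictNests U W)

/-- `V` is an outer block of `π`: it is minimal in the nesting order. -/
def IsOuter (π : SetPartition n) (V : Finset (Fin n)) : Prop :=
  ∀ U ∈ π.parts, ¬ StrictNests U V

/-- The blocks of `π`, listed in the order of their minimal elements. -/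
def blockList (π : SetPartition n) : List {V // V ∈ π.parts} :=
  ((List.finRange n).filter fun i => decide (∀ j ∈ π.part i, i ≤ j)).map
    fun i => ⟨π.part i, π.part_mem.2 (Finset.mem_univ i)⟩

theorem min_lt_min_of_strictNests {π : SetPartition n} {V W : Finset (Fin n)}
    (hV : V ∈ π.parts) (hW : W ∈ π.parts) (h : StrictNests V W) :
    V.min' (π.nonempty_of_mem_parts hV) < W.min' (π.nonempty_of_mem_parts hW) := by
  obtain ⟨x, hx, hxle⟩ := (h.1 _ (W.min'_mem (π.nonempty_of_mem_parts hW))).1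
  refine lt_of_le_of_ne ((V.min'_le x hx).trans hxle) fun heq => h.2 ?_
  exact π.eq_of_mem_parts hV hW (V.min'_mem _) (heq ▸ W.min'_mem _)

open Classical in
/-- The tree of nestings below (and including) the block `V` of `π`: the children of a block are
the blocks that it covers. -/
noncomputable def nestingTree (π : SetPartition n) (V : {V // V ∈ π.parts}) : PlanarTree :=
  .node (((blockList π).filter fun W => decide (Covers π V.1 W.1)).attach.map
    fun W => nestingTree π W.1)
termination_by n - (V.1.min' (π.nonempty_of_mem_parts V.2) : ℕ)
decreasing_by
  have hW := (List.mem_filter.1 W.2).2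
  have hlt := min_lt_min_of_strictNests V.2 W.1.2 (of_decide_eq_true hW).1
  have := (W.1.1.min' (π.nonempty_of_mem_parts W.1.2)).2
  have _hlt : (V.1.min' (π.nonempty_of_mem_parts V.2) : ℕ)
      < (W.1.1.min' (π.nonempty_of_mem_parts W.1.2) : ℕ) := hlt
  omega

open Classical in
/-- The forest of nestings `t(π)`: the trees of nestings of the irreducible components of `π`,
whose roots are the outer blocks. -/
noncomputable def nestingForest (π : SetPartition n) : List PlanarTree :=
  ((blockList π).filter fun V => decide (IsOuter π V.1)).map (nestingTree π)

/-- The factorial `t(π)!` of the forest of nestings. -/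
noncomputable def nestingFactorial (π : SetPartition n) : ℕ :=
  ((nestingForest π).map PlanarTree.factorial).prod

end Nesting

/-! ### Moments and monotone cumulants -/

/-- `f_π(a₁, …, aₙ) = ∏_{V ∈ π} f_{|V|}(a_{i₁}, …, a_{iₛ})`, where `V = {i₁ < ⋯ < iₛ}`. -/
def partitionEval {A : Type*} (f : (m : ℕ) → (Fin m → A) → ℂ) {n : ℕ} (π : SetPartition n)
    (a : Fin n → A) : ℂ :=
  ∏ V ∈ π.parts, f V.card fun i => a (V.orderEmbOfFin rfl i)

/-- The moments `φ_n(a₁, …, aₙ) = φ(a₁ ⋯ aₙ)`. -/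
def moment {A : Type*} [Ring A] [Algebra ℂ A] (φ : A →ₗ[ℂ] ℂ) (n : ℕ) (a : Fin n → A) : ℂ :=
  φ (List.ofFn a).prod

/-- `h` is the family of monotone cumulants of `(A, φ)`: the multilinear functionals `h_n`, `n ≥ 1`,
are determined recursively by `φ_n = ∑_{π ∈ NC(n)} h_π / t(π)!`.
(The functional `h 0` plays no role.) -/
def IsMonotoneCumulants {A : Type*} [Ring A] [Algebra ℂ A] (φ : A →ₗ[ℂ] ℂ)
    (h : (n : ℕ) → MultilinearMap ℂ (fun _ : Fin n => A) ℂ) : Prop :=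
  ∀ n : ℕ, 1 ≤ n → ∀ a : Fin n → A,
    moment φ n a =
      ∑ π ∈ NC n, (1 / (nestingFactorial π : ℂ)) * partitionEval (fun m => ⇑(h m)) π a

/-! ### The monotone cumulants exist and are unique -/

theorem PlanarTree.size_pos : ∀ t : PlanarTree, 0 < t.size
  | .node ts => by rw [PlanarTree.size]; omega

theorem PlanarTree.factorial_pos : ∀ t : PlanarTree, 0 < t.factorial
  | .node ts => by
    rw [PlanarTree.factorial]
    refine Nat.mul_pos (PlanarTree.size_pos _) (List.prod_pos ?_)
    intro x hx
    obtain ⟨t, ht, rfl⟩ := List.mem_map.1 hx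
    exact PlanarTree.factorial_pos t

theorem nestingFactorial_pos {n : ℕ} (π : SetPartition n) : 0 < nestingFactorial π := by
  refine List.prod_pos fun x hx => ?_
  obtain ⟨t, _, rfl⟩ := List.mem_map.1 hx
  exact t.factorial_pos

/-- The partition `1_n` with a single block. -/
def oneBlock (n : ℕ) (hn : 1 ≤ n) : SetPartition n :=
  Finpartition.indiscrete (a := (Finset.univ : Finset (Fin n)))
    (Finset.univ_nonempty_iff.2 ⟨⟨0, hn⟩⟩).ne_empty

theorem oneBlock_mem_NC (n : ℕ) (hn : 1 ≤ n) : oneBlock n hn ∈ NC n := by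
  classical
  simp only [NC, Finset.mem_filter, Finset.mem_univ, true_and]
  intro V hV W hW
  simp only [oneBlock, Finpartition.indiscrete_parts, Finset.mem_singleton] at hV hW
  simp [hV, hW]

theorem card_lt_of_ne_oneBlock {n : ℕ} (hn : 1 ≤ n) {π : SetPartition n} (hπ : π ≠ oneBlock n hn)
    {V : Finset (Fin n)} (hV : V ∈ π.parts) : V.card < n := by
  have hle : V.card ≤ n := by simpa using Finset.card_le_univ V
  refine lt_of_le_of_ne hle fun hc => hπ ?_
  have hu : V = Finset.univ := Finset.eq_univ_of_card V (by simpa using hc)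
  subst hu
  have hp : π.parts = {Finset.univ} := by
    refine Finset.eq_singleton_iff_unique_mem.2 ⟨hV, fun W hW => ?_⟩
    obtain ⟨x, hx⟩ := π.nonempty_of_mem_parts hW
    exact π.eq_of_mem_parts hW hV hx (Finset.mem_univ x)
  exact Finpartition.ext (by rw [hp, oneBlock, Finpartition.indiscrete_parts])

theorem partitionEval_congr {A : Type*} {f g : (m : ℕ) → (Fin m → A) → ℂ} {n : ℕ}
    {π : SetPartition n} (h : ∀ V ∈ π.parts, f V.card = g V.card) (a : Fin n → A) :
    partitionEval f π a = partitionEval g π a :=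
  Finset.prod_congr rfl fun V hV => by rw [h V hV]

theorem partitionEval_oneBlock {A : Type*} (f : (m : ℕ) → (Fin m → A) → ℂ) {n : ℕ} (hn : 1 ≤ n)
    (a : Fin n → A) : partitionEval f (oneBlock n hn) a = f n a := by
  have key : ∀ (m : ℕ) (hm : (Finset.univ : Finset (Fin n)).card = m) (e : Fin m ↪o Fin n),
      f m (fun i => a (e i)) = f n a := by
    intro m hm e
    obtain rfl : m = n := by simpa using hm.symm
    congr 1
    funext i
    exact congrArg a (DFunLike.congr_fun (Subsingleton.elim
      (OrderIso.ofRelIsoLT (RelIso.ofSurjective e.ltEmbedding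
        (Finite.surjective_of_injective e.injective))) (OrderIso.refl (Fin m))) i)
  simp only [partitionEval, oneBlock, Finpartition.indiscrete_parts, Finset.prod_singleton]
  exact key _ rfl _

theorem partitionEval_update {A : Type*} (f : (m : ℕ) → (Fin m → A) → ℂ) {n : ℕ} (π : SetPartition n)
    (a : Fin n → A) (i : Fin n) : ∃ (k : Fin (π.part i).card) (b : Fin (π.part i).card → A) (c : ℂ),
      ∀ x, partitionEval f π (Function.update a i x)
        = f (π.part i).card (Function.update b k x) * c := by
  have hi : i ∈ π.part i := π.mem_part (Finset.mem_univ i)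
  have hmem : π.part i ∈ π.parts := π.part_mem.2 (Finset.mem_univ i)
  obtain ⟨k, hk⟩ : ∃ k, (π.part i).orderEmbOfFin rfl k = i := by
    have : i ∈ Set.range ((π.part i).orderEmbOfFin rfl) := by
      rw [Finset.range_orderEmbOfFin]; exact hi
    exact this
  refine ⟨k, fun j => a ((π.part i).orderEmbOfFin rfl j),
    ∏ V ∈ π.parts.erase (π.part i), f V.card fun j => a (V.orderEmbOfFin rfl j), fun x => ?_⟩
  rw [partitionEval, ← Finset.mul_prod_erase _ _ hmem]
  congr 1
  · congr 1
    funext j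
    by_cases hj : j = k
    · subst hj; simp [hk]
    · have : (π.part i).orderEmbOfFin rfl j ≠ i := fun h =>
        hj (((π.part i).orderEmbOfFin rfl).injective (h.trans hk.symm))
      simp [hj, this]
  · refine Finset.prod_congr rfl fun V hV => ?_
    congr 1
    funext j
    have : V.orderEmbOfFin rfl j ≠ i := fun h => by
      refine (Finset.mem_erase.1 hV).1 (π.part_eq_of_mem (Finset.mem_erase.1 hV).2 ?_).symm
      exact h ▸ Finset.orderEmbOfFin_mem V rfl j
    simp [this]

section Existence

variable {A : Type*} [Ring A] [Algebra ℂ A]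

/-- `f_π` is multilinear if the `f_m` are. -/
def partitionMultilinear (f : (m : ℕ) → MultilinearMap ℂ (fun _ : Fin m => A) ℂ) {n : ℕ}
    (π : SetPartition n) : MultilinearMap ℂ (fun _ : Fin n => A) ℂ where
  toFun := partitionEval (fun m => ⇑(f m)) π
  map_update_add' := by
    intro inst a i x y
    obtain rfl : inst = instDecidableEqFin n := Subsingleton.elim _ _
    obtain ⟨k, b, c, h⟩ := partitionEval_update (fun m => ⇑(f m)) π a i
    simp only [h, MultilinearMap.map_update_add, add_mul]
  map_update_smul' := by
    intro inst a i r x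
    obtain rfl : inst = instDecidableEqFin n := Subsingleton.elim _ _
    obtain ⟨k, b, c, h⟩ := partitionEval_update (fun m => ⇑(f m)) π a i
    simp only [h, MultilinearMap.map_update_smul, smul_eq_mul, mul_assoc]

theorem partitionMultilinear_apply (f : (m : ℕ) → MultilinearMap ℂ (fun _ : Fin m => A) ℂ) {n : ℕ}
    (π : SetPartition n) (a : Fin n → A) :
    partitionMultilinear f π a = partitionEval (fun m => ⇑(f m)) π a := rfl

open Classical in
/-- The recursion for the monotone cumulants, solved for the term of the one-block partition. -/
noncomputable def cumulant (φ : A →ₗ[ℂ] ℂ) (n : ℕ) : MultilinearMap ℂ (fun _ : Fin n => A) ℂ :=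
  if hn : 1 ≤ n then
    (nestingFactorial (oneBlock n hn) : ℂ) • (φ.compMultilinearMap (MultilinearMap.mkPiAlgebraFin ℂ n A)
      - ∑ π ∈ (NC n).erase (oneBlock n hn), (1 / (nestingFactorial π : ℂ)) •
        partitionMultilinear (fun m => if _hm : m < n then cumulant φ m else 0) π)
  else 0
termination_by n

theorem sum_NC_eq (h : (n : ℕ) → MultilinearMap ℂ (fun _ : Fin n => A) ℂ) {n : ℕ} (hn : 1 ≤ n)
    (a : Fin n → A) [DecidableEq (SetPartition n)] :
    ∑ π ∈ NC n, (1 / (nestingFactorial π : ℂ)) * partitionEval (fun m => ⇑(h m)) π a =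
      (1 / (nestingFactorial (oneBlock n hn) : ℂ)) * h n a +
      ∑ π ∈ (NC n).erase (oneBlock n hn),
        (1 / (nestingFactorial π : ℂ)) * partitionEval (fun m => ⇑(h m)) π a := by
  rw [← Finset.add_sum_erase _ _ (oneBlock_mem_NC n hn), partitionEval_oneBlock]

theorem isMonotoneCumulants_cumulant (φ : A →ₗ[ℂ] ℂ) : IsMonotoneCumulants φ (cumulant φ) := by
  classical
  intro n hn a
  have hne : (nestingFactorial (oneBlock n hn) : ℂ) ≠ 0 :=
    Nat.cast_ne_zero.2 (nestingFactorial_pos _).ne'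
  rw [sum_NC_eq _ hn]
  have hrec : cumulant φ n a = (nestingFactorial (oneBlock n hn) : ℂ) * (moment φ n a -
      ∑ π ∈ (NC n).erase (oneBlock n hn), (1 / (nestingFactorial π : ℂ)) *
        partitionEval (fun m => ⇑(cumulant φ m)) π a) := by
    rw [cumulant, dif_pos hn]
    simp only [_root_.smul_apply, _root_.sub_apply, _root_.sum_apply,
      LinearMap.compMultilinearMap_apply, MultilinearMap.mkPiAlgebraFin_apply, smul_eq_mul]
    congr 2
    refine Finset.sum_congr (by congr!) fun π hπ => ?_
    congr 1
    rw [partitionMultilinear_apply]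
    refine partitionEval_congr (fun V hV => ?_) a
    have hlt := card_lt_of_ne_oneBlock hn (Finset.mem_erase.1 hπ).1 hV
    simp [hlt]
  rw [hrec, ← mul_assoc, one_div_mul_cancel hne]
  ring

theorem IsMonotoneCumulants.unique {φ : A →ₗ[ℂ] ℂ}
    {h g : (n : ℕ) → MultilinearMap ℂ (fun _ : Fin n => A) ℂ} (hh : IsMonotoneCumulants φ h)
    (hg : IsMonotoneCumulants φ g) (n : ℕ) (hn : 1 ≤ n) : h n = g n := by
  classical
  induction n using Nat.strong_induction_on with
  | _ n ih =>
    ext a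
    have hne : (1 / (nestingFactorial (oneBlock n hn) : ℂ)) ≠ 0 :=
      one_div_ne_zero (Nat.cast_ne_zero.2 (nestingFactorial_pos _).ne')
    have e := (hh n hn a).symm.trans (hg n hn a)
    rw [sum_NC_eq _ hn, sum_NC_eq _ hn] at e
    have e2 : ∑ π ∈ (NC n).erase (oneBlock n hn),
        (1 / (nestingFactorial π : ℂ)) * partitionEval (fun m => ⇑(h m)) π a =
        ∑ π ∈ (NC n).erase (oneBlock n hn),
        (1 / (nestingFactorial π : ℂ)) * partitionEval (fun m => ⇑(g m)) π a := by
      refine Finset.sum_congr rfl fun π hπ => ?_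
      congr 1
      refine partitionEval_congr (fun V hV => ?_) a
      have hlt := card_lt_of_ne_oneBlock hn (Finset.mem_erase.1 hπ).1 hV
      have hpos := (π.nonempty_of_mem_parts hV).card_pos
      exact congrArg _ (ih _ hlt hpos)
    rw [e2] at e
    exact mul_left_cancel₀ hne (add_right_cancel e)

end Existence

/-! ### Schröder trees with `n + 1` leaves -/

theorem PlanarTree.IsSchroeder.one_le_numLeaves {t : PlanarTree} (ht : t.IsSchroeder) :
    1 ≤ t.numLeaves := by
  induction ht with
  | leaf => simp [PlanarTree.numLeaves]
  | branch ts h2 _ ih =>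
    cases ts with
    | nil => simp at h2
    | cons s l =>
      have := ih s (by simp)
      simp only [PlanarTree.numLeaves, List.isEmpty_cons, List.map_cons, List.sum_cons]
      simp
      omega

theorem finite_schroeder (m : ℕ) : {t : PlanarTree | t.IsSchroeder ∧ t.numLeaves ≤ m}.Finite := by
  induction m with
  | zero =>
    refine Set.Finite.subset Set.finite_empty fun t ht => ?_
    have := ht.1.one_le_numLeaves
    have := ht.2
    omega
  | succ m ih =>
    set S := {t : PlanarTree | t.IsSchroeder ∧ t.numLeaves ≤ m} with hS
    have : Finite S := ih
    have hfin := ((List.finite_length_le S (m + 1)).image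
      (fun l : List S => PlanarTree.node (l.map Subtype.val)))
    refine hfin.subset ?_
    rintro t ⟨ht, hle⟩
    cases ht with
    | leaf => exact ⟨[], by simp, by simp⟩
    | branch ts h2 h =>
      have hne : ts.isEmpty = false := by
        cases ts with
        | nil => simp at h2
        | cons => rfl
      simp only [PlanarTree.numLeaves, hne] at hle
      simp at hle
      have key : ∀ l : List PlanarTree, (∀ t ∈ l, t.IsSchroeder) →
          l.length ≤ (l.map PlanarTree.numLeaves).sum := by
        intro l hl
        induction l with
        | nil => simp
        | cons t l ihl =>
          have h1 := (hl t (by simp)).one_le_numLeaves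
          have h2 := ihl fun t ht => hl t (by simp [ht])
          simp
          omega
      have hmem : ∀ t ∈ ts, t ∈ S := by
        intro t ht
        refine ⟨h t ht, ?_⟩
        obtain ⟨l₁, l₂, rfl⟩ := List.append_of_mem ht
        have k1 := key l₁ fun t ht => h t (by simp [ht])
        have k2 := key l₂ fun t ht => h t (by simp [ht])
        simp at hle h2
        omega
      have hlen := key ts h
      refine ⟨ts.attach.map fun t => ⟨t.1, hmem t.1 t.2⟩, ?_, ?_⟩
      · simp
        omega
      · simp [Function.comp_def]

/-- The finite set `ST(n)` of Schröder trees with `n + 1` leaves. -/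
noncomputable def ST (n : ℕ) : Finset PlanarTree :=
  Set.Finite.toFinset (s := {t | t.IsSchroeder ∧ t.numLeaves = n + 1})
    ((finite_schroeder (n + 1)).subset fun _ ht => ⟨ht.1, ht.2.le⟩)

open Classical in
/-- The partition `π(t)` of the `n` sectors of a tree `t` with `n + 1` leaves: two sectors lie in
the same block if and only if they are sectors of the corolla of the same internal vertex. -/
noncomputable def treePartition (n : ℕ) (t : PlanarTree) : SetPartition n :=
  Finpartition.ofSetoid (Setoid.ker fun i : Fin n => t.sectorList[(i : ℕ)]?)

open Classical in
/-- The coefficient `α(π) = ∑_{t ∈ ST(n), π(t) = π} ω(sk(t))`. -/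
noncomputable def alpha {n : ℕ} (π : SetPartition n) : ℚ :=
  ∑ t ∈ (ST n).filter (fun t => treePartition n t = π), t.skeleton.murua

end NCProb

/-! Functionals on words over `A` compose: `wordComp f G` sums, over all ways to select letters of a
word, `f` at the selected subword times the product of `G` over the gaps. This product is
associative, has the unit `emptyWord`, and is linear in its left argument. The monotone cumulants
are the logarithm of the moments for it.

For `ρ` vanishing at the empty word, the flow equation `X' = ρ ∘ X` starting at the unit has the
explicit polynomial solution `expFlow ρ`: the sum over Schröder trees with weight `X ^ |s| / s!`,
where `s` is the skeleton. The root of a tree selects the letters in its sectors and the subtrees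
fill the gaps, so a recursion for the weights becomes a composition equation (`treeSum_add_mul`).

At time `1` the weights are inverse skeleton factorials. Grouped by the partition of the tree they
add up to `1 / t(π)!` (`sum_inv_factorial_skeleton`): for the indicator of the blocks of `π` the
flow equation is solved a second time, now by a product of hook weights `X / #(below π V)`. So the
relation defining the cumulants says that the flow generated by `h` takes the values `φ(a₁ ⋯ aₙ)` at
time `1`.

By the semigroup property, the flow at time `N` is the `N`-fold composition power of the moments.
The same tree recursion expands this power over Schröder trees, with the number of strict maps from
the skeleton to an `N`-chain as weight (`strictCount_node_succ`). That number is `∑ ω_k * N.choose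
k`, so both expansions are polynomial in `N`. Their linear coefficients are `h` on one side
(`coeff_one_expFlow`) and the sum with the Murua coefficients on the other, because `N.choose k` has
linear coefficient `(-1) ^ (k + 1) / k`. -/

namespace NCProb

/-! ### Composition of functionals on words -/

section WordComp

variable {A R S : Type*} [CommSemiring R] [CommSemiring S]

/-- Scanning a word letter by letter: `f` is applied to the subword of the selected letters, `G` to
the maximal runs of letters that are not selected, with `g` in place of `G` for the first run. -/
def compAux (G : List A → R) : List A → (List A → R) → (List A → R) → R
  | [], f, g => f [] * g []
  | a :: w, f, g =>
    compAux G w f (fun v => g (a :: v)) + g [] * compAux G w (fun v => f (a :: v)) G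

/-- The sum, over all subwords of `w`, of `f` at the subword times the product of the values of `G`
at the words that fill the gaps between its letters. -/
def wordComp (f G : List A → R) (w : List A) : R := compAux G w f G

/-- The functional equal to `1` at the empty word and to `0` at all other words. -/
def emptyWord (w : List A) : R := if w.isEmpty then 1 else 0

theorem compAux_add_left (G : List A → R) (w : List A) (f f' g : List A → R) :
    compAux G w (fun v => f v + f' v) g = compAux G w f g + compAux G w f' g := by
  induction w generalizing f f' g with
  | nil => simp [compAux, add_mul]
  | cons a w ih => simp only [compAux, ih]; ring

theorem compAux_add_right (G : List A → R) (w : List A) (f g g' : List A → R) :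
    compAux G w f (fun v => g v + g' v) = compAux G w f g + compAux G w f g' := by
  induction w generalizing f g g' with
  | nil => simp [compAux, mul_add]
  | cons a w ih => simp only [compAux, ih]; ring

theorem compAux_mul_left (G : List A → R) (w : List A) (c : R) (f g : List A → R) :
    compAux G w (fun v => c * f v) g = c * compAux G w f g := by
  induction w generalizing f g with
  | nil => simp [compAux, mul_assoc]
  | cons a w ih => simp only [compAux, ih]; ring

theorem compAux_mul_right (G : List A → R) (w : List A) (c : R) (f g : List A → R) :
    compAux G w f (fun v => c * g v) = c * compAux G w f g := by
  induction w generalizing f g with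
  | nil => simp [compAux, mul_left_comm]
  | cons a w ih => simp only [compAux, ih]; ring

theorem compAux_zero_left (G : List A → R) (w : List A) (g : List A → R) :
    compAux G w (fun _ => 0) g = 0 := by
  simpa using compAux_mul_left G w 0 (fun _ => 0) g

theorem compAux_zero_right (G : List A → R) (w : List A) (f : List A → R) :
    compAux G w f (fun _ => 0) = 0 := by
  simpa using compAux_mul_right G w 0 f (fun _ => 0)

theorem compAux_sum_left {ι : Type*} (s : Finset ι) (G : List A → R) (w : List A)
    (f : ι → List A → R) (g : List A → R) :
    compAux G w (fun v => ∑ i ∈ s, f i v) g = ∑ i ∈ s, compAux G w (f i) g := by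
  classical
  induction s using Finset.induction_on with
  | empty => simpa using compAux_zero_left G w g
  | insert i s hi ih => simp only [Finset.sum_insert hi, compAux_add_left, ih]

theorem map_compAux (ψ : R →+* S) (G : List A → R) (w : List A) (f g : List A → R) :
    ψ (compAux G w f g) = compAux (fun v => ψ (G v)) w (fun v => ψ (f v)) (fun v => ψ (g v)) := by
  induction w generalizing f g with
  | nil => simp [compAux]
  | cons a w ih => simp [compAux, ih]

theorem map_wordComp (ψ : R →+* S) (f G : List A → R) (w : List A) :
    ψ (wordComp f G w) = wordComp (fun v => ψ (f v)) (fun v => ψ (G v)) w :=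
  map_compAux ψ G w f G

/-- Both sides run over chains of two subwords, the inner one fed to `f`. Keeping separate
functionals for the first run at each level is what lets the induction on the word go through. -/
theorem compAux_assoc (G H : List A → R) (w : List A) (f g k : List A → R) :
    compAux H w (fun v => compAux G v f g) k =
      compAux (wordComp G H) w f (fun v => compAux H v g k) := by
  induction w generalizing f g k with
  | nil => simp [compAux, mul_assoc]
  | cons a w ih =>
    simp only [compAux, ih, compAux_add_left, compAux_add_right, compAux_mul_left,
      compAux_mul_right]
    rw [show (fun v => compAux H v G H) = wordComp G H from rfl]
    ring

theorem wordComp_assoc (f G H : List A → R) :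
    wordComp (wordComp f G) H = wordComp f (wordComp G H) :=
  funext fun w => compAux_assoc G H w f G H

theorem compAux_emptyWord_left (G : List A → R) (w : List A) (g : List A → R) :
    compAux G w emptyWord g = g w := by
  induction w generalizing g with
  | nil => simp [compAux, emptyWord]
  | cons a w ih =>
    have : (fun v => emptyWord (a :: v)) = fun _ : List A => (0 : R) := by
      funext v; simp [emptyWord]
    rw [compAux, ih, this, compAux_zero_left, mul_zero, add_zero]

theorem wordComp_emptyWord_left (G : List A → R) : wordComp emptyWord G = G :=
  funext fun w => compAux_emptyWord_left G w G

theorem wordComp_emptyWord_right (f : List A → R) : wordComp f emptyWord = f := by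
  funext w
  induction w generalizing f with
  | nil => simp [wordComp, compAux, emptyWord]
  | cons a w ih =>
    have h : (fun v => emptyWord (a :: v)) = fun _ : List A => (0 : R) := by
      funext v; simp [emptyWord]
    have ih' := ih fun v => f (a :: v)
    rw [wordComp] at ih' ⊢
    rw [compAux, h, compAux_zero_right, ih']
    simp [emptyWord]

/-- The whole word occurs as a gap only in the term of the empty selection, whose other factor is `f
[]`; all other gaps are shorter. This drives every induction on the length of a word. -/
theorem compAux_congr {G G' : List A → R} (w : List A) {f g g' : List A → R}
    (hG : ∀ v : List A, v.length < w.length → G v = G' v)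
    (hg : ∀ v : List A, v.length < w.length → g v = g' v) (hw : f [] = 0 ∨ g w = g' w) :
    compAux G w f g = compAux G' w f g' := by
  induction w generalizing f g g' with
  | nil => rcases hw with h | h <;> simp [compAux, h]
  | cons a w ih =>
    rw [compAux, compAux, hg [] (by simp)]
    congr 1
    · refine ih (fun v hv => hG v (by simp; omega)) (fun v hv => hg _ (by simp; omega)) ?_
      simpa using hw
    · congr 1
      exact ih (fun v hv => hG v (by simp; omega)) (fun v hv => hG v (by simp; omega))
        (Or.inr (hG _ (by simp)))

theorem wordComp_congr {f G G' : List A → R} (w : List A) (hf : f [] = 0)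
    (hG : ∀ v : List A, v.length < w.length → G v = G' v) :
    wordComp f G w = wordComp f G' w :=
  compAux_congr w hG hG (Or.inl hf)

/-- The selections are sorted by their first selected letter. -/
theorem compAux_eq_sum (G : List A → R) (w : List A) (f g : List A → R) :
    compAux G w f g = f [] * g w + ∑ i : Fin w.length,
      g (w.take i) * wordComp (fun v => f (w[i] :: v)) G (w.drop (i + 1)) := by
  induction w generalizing g with
  | nil => simp [compAux]
  | cons a w ih =>
    rw [compAux, ih]
    simp only [List.length_cons]
    rw [Fin.sum_univ_succ]
    simp [wordComp]
    ring

end WordComp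

/-! ### Polynomial flows: uniqueness and the semigroup property -/

section Derivative

open Polynomial

variable {A R : Type*} [CommRing R]

theorem derivative_compAux (G : List A → R) (w : List A) (f : List A → R[X]) (g : List A → R) :
    derivative (compAux (fun v => C (G v)) w f (fun v => C (g v))) =
      compAux (fun v => C (G v)) w (fun v => derivative (f v)) (fun v => C (g v)) := by
  induction w generalizing f g with
  | nil => simp [compAux, mul_comm]
  | cons a w ih => simp [compAux, ih]

theorem eq_of_derivative_eq_of_eval_zero_eq [CharZero R] [IsDomain R] {p q : R[X]}
    (h : derivative p = derivative q) (h0 : p.eval 0 = q.eval 0) : p = q := by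
  have h1 : derivative (p - q) = 0 := by simp [h]
  have h2 := derivative_eq_zero.1 h1
  rw [natDegree_eq_zero] at h2
  obtain ⟨c, hc⟩ := h2
  have h3 : (p - q).eval 0 = 0 := by simp [h0]
  rw [← hc, eval_C] at h3
  rw [h3, C_0] at hc
  exact sub_eq_zero.1 hc.symm

/-- The flow equation `X' = ρ ∘ X` has at most one polynomial solution with a given initial
value. -/
theorem flow_unique [CharZero R] [IsDomain R] {ρ U V : List A → R[X]} (hρ : ρ [] = 0)
    (hU : ∀ w, derivative (U w) = wordComp ρ U w) (hV : ∀ w, derivative (V w) = wordComp ρ V w)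
    (h0 : ∀ w, (U w).eval 0 = (V w).eval 0) (w : List A) : U w = V w := by
  induction hn : w.length using Nat.strong_induction_on generalizing w with
  | _ n ih =>
    refine eq_of_derivative_eq_of_eval_zero_eq ?_ (h0 w)
    -- Since `ρ [] = 0`, the right-hand side of the flow equation involves only shorter words.
    rw [hU, hV]
    exact wordComp_congr w hρ fun v hv => ih v.length (hn ▸ hv) v rfl

/-- A solution of the flow equation that starts at the unit is a one-parameter semigroup. -/
theorem flow_semigroup [CharZero R] [IsDomain R] {ρ : List A → R} {G : List A → R[X]}
    (hρ : ρ [] = 0) (hG : ∀ w, derivative (G w) = wordComp (fun v => C (ρ v)) G w)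
    (h0 : ∀ w, (G w).eval 0 = emptyWord w) (s r : R) (w : List A) :
    (G w).eval (s + r) =
      wordComp (fun v => (G v).eval s) (fun v => (G v).eval r) w := by
  -- As functions of `s` with `r` fixed, both sides solve the flow equation with the value at time
  -- `r` as initial value; for the right side this uses associativity and left linearity.
  have key := flow_unique (ρ := fun v => C (ρ v))
    (U := fun w => (G w).comp (X + C r))
    (V := wordComp G fun v => C ((G v).eval r)) (by simp [hρ]) ?_ ?_ ?_ w
  · have := congrArg (eval s) key
    simp only [eval_comp, eval_add, eval_X, eval_C] at this
    rw [this, ← coe_evalRingHom, map_wordComp]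
    simp
  · intro w
    rw [derivative_comp, hG]
    have := map_wordComp (compRingHom (X + C r)) (fun v => C (ρ v)) G w
    simpa using this
  · intro w
    rw [wordComp, derivative_compAux, ← wordComp_assoc]
    simp only [hG]
    rfl
  · intro w
    have := map_wordComp (evalRingHom 0) G (fun v => C ((G v).eval r)) w
    simp only [coe_evalRingHom, eval_C, h0] at this
    rw [this]
    have e := congrFun (wordComp_emptyWord_left fun v => (G v).eval r) w
    simpa using e.symm

end Derivative

/-! ### Sector labels of a tree and their noncrossing property -/

namespace PlanarTree

@[elab_as_elim]
theorem induction {P : PlanarTree → Prop}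
    (h : ∀ ts : List PlanarTree, (∀ t ∈ ts, P t) → P (node ts)) : ∀ t, P t
  | node ts => h ts fun t _ => induction h t

/-- The sectors of the corolla and the subtrees of a list of trees grafted to a common root, the
first tree having the child index `j`. -/
def forestSectors : ℕ → List PlanarTree → List (List ℕ)
  | _, [] => []
  | j, [t] => t.sectorList.map (j :: ·)
  | j, t :: s :: ts => t.sectorList.map (j :: ·) ++ [] :: forestSectors (j + 1) (s :: ts)

theorem sectorList_node (ts : List PlanarTree) : (node ts).sectorList = forestSectors 0 ts := by
  have key : ∀ j, List.intercalate [[]]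
      ((ts.map sectorList).mapIdx fun i l => l.map ((j + i) :: ·)) = forestSectors j ts := by
    induction ts with
    | nil => intro j; rfl
    | cons t ts ih =>
      intro j
      cases ts with
      | nil => simp [forestSectors]
      | cons s ts =>
        have := ih (j + 1)
        simp only [List.map_cons, List.mapIdx_cons, forestSectors, List.intercalate_cons_cons,
          add_zero] at this ⊢
        rw [← this]
        simp [add_assoc, add_comm 1]
  rw [sectorList]
  simpa using key 0

theorem numLeaves_node {ts : List PlanarTree} (h : ts ≠ []) :
    (node ts).numLeaves = (ts.map numLeaves).sum := by
  simp [numLeaves, h]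

theorem length_sectorList (t : PlanarTree) : t.sectorList.length + 1 = t.numLeaves := by
  induction t using PlanarTree.induction with
  | h ts ih =>
    have key : ∀ j, ts ≠ [] → (forestSectors j ts).length + 1 = (ts.map numLeaves).sum := by
      induction ts with
      | nil => simp
      | cons t ts iht =>
        intro j _
        cases ts with
        | nil => simpa [forestSectors] using ih t (by simp)
        | cons s ts =>
          have h1 := iht (fun t ht => ih t (List.mem_cons_of_mem _ ht)) (j + 1) (by simp)
          have h2 := ih t (by simp)
          simp only [forestSectors, List.length_append, List.length_map, List.length_cons,
            List.map_cons, List.sum_cons] at h1 ⊢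
          omega
    rw [sectorList_node]
    by_cases h : ts = []
    · subst h; simp [forestSectors, numLeaves]
    · rw [numLeaves_node h, key 0 h]

theorem numLeaves_pos (t : PlanarTree) : 0 < t.numLeaves := by
  rw [← length_sectorList]; omega

theorem head_of_mem_forestSectors {ts : List PlanarTree} {j : ℕ} {x : List ℕ}
    (hx : x ∈ forestSectors j ts) : x = [] ∨ ∃ i l, j ≤ i ∧ x = i :: l := by
  induction ts generalizing j with
  | nil => simp [forestSectors] at hx
  | cons t ts ih =>
    cases ts with
    | nil =>
      simp only [forestSectors, List.mem_map] at hx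
      obtain ⟨l, _, rfl⟩ := hx
      exact Or.inr ⟨j, l, le_rfl, rfl⟩
    | cons s ts =>
      simp only [forestSectors, List.mem_append, List.mem_map, List.mem_cons] at hx
      rcases hx with ⟨l, _, rfl⟩ | rfl | hx
      · exact Or.inr ⟨j, l, le_rfl, rfl⟩
      · exact Or.inl rfl
      · rcases ih hx with rfl | ⟨i, l, hi, rfl⟩
        · exact Or.inl rfl
        · exact Or.inr ⟨i, l, by omega, rfl⟩

theorem not_mem_of_mem_map_cons {j : ℕ} {L : List (List ℕ)} {ts : List PlanarTree} {x : List ℕ}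
    (hx : x ∈ L.map (j :: ·)) : x ∉ [] :: forestSectors (j + 1) ts := by
  obtain ⟨l, _, rfl⟩ := List.mem_map.1 hx
  intro h
  rcases List.mem_cons.1 h with h | h
  · simp at h
  · rcases head_of_mem_forestSectors h with h | ⟨i, l', hi, h⟩
    · simp at h
    · simp only [List.cons.injEq] at h
      omega

/-- The labels of a list are noncrossing: no two different labels alternate. -/
def NoncrossingLabels {Λ : Type*} (L : List Λ) : Prop :=
  ∀ x y, [x, y, x, y].Sublist L → x = y

/-- The labels of `P` occur nowhere else, so a pattern `x, y, x, y` cannot be split between `P` and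
what follows it. The root label `[]` in front ensures that the sectors of the root to the left of
`P` are taken into account. -/
theorem noncrossingLabels_append {P Q : List (List ℕ)} (hP : NoncrossingLabels P)
    (hQ : NoncrossingLabels ([] :: Q)) (hPQ : ∀ x ∈ P, x ∉ [] :: Q) :
    NoncrossingLabels ([] :: (P ++ [] :: Q)) := by
  have hnil : [] ∉ P := fun h => hPQ _ h (by simp)
  intro x y hxy
  by_contra hne
  have h1 : ∀ {l : List (List ℕ)}, [x, y, x, y].Sublist (P ++ l) → l = [] :: Q → False := by
    rintro l h rfl
    obtain ⟨l₁, l₂, e, h1, h2⟩ := List.sublist_append_iff.1 h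
    rcases l₁ with _ | ⟨b₁, _ | ⟨b₂, _ | ⟨b₃, _ | ⟨b₄, _ | ⟨b₅, l⟩⟩⟩⟩⟩
    · simp only [List.nil_append] at e
      subst e
      exact hne (hQ x y h2)
    · simp only [List.cons_append, List.nil_append, List.cons.injEq] at e
      obtain ⟨rfl, rfl⟩ := e
      exact hPQ x (h1.subset (by simp)) (h2.subset (by simp))
    · simp only [List.cons_append, List.nil_append, List.cons.injEq] at e
      obtain ⟨rfl, rfl, rfl⟩ := e
      exact hPQ x (h1.subset (by simp)) (h2.subset (by simp))
    · simp only [List.cons_append, List.nil_append, List.cons.injEq] at e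
      obtain ⟨rfl, rfl, rfl, rfl⟩ := e
      exact hPQ y (h1.subset (by simp)) (h2.subset (by simp))
    · simp only [List.cons_append, List.nil_append, List.cons.injEq] at e
      obtain ⟨rfl, rfl, rfl, rfl, -⟩ := e
      exact hne (hP _ _ h1)
    · simp at e
  rcases List.sublist_cons_iff.1 hxy with h | ⟨r, hr, h⟩
  · exact h1 h rfl
  · simp only [List.cons.injEq] at hr
    obtain ⟨rfl, rfl⟩ := hr
    have hy : y ≠ [] := fun e => hne e.symm
    obtain ⟨l₁, l₂, e, h1, h2⟩ := List.sublist_append_iff.1 h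
    rcases l₁ with _ | ⟨b₁, _ | ⟨b₂, l⟩⟩
    · simp only [List.nil_append] at e
      subst e
      rcases List.sublist_cons_iff.1 h2 with h3 | ⟨r, hr, _⟩
      · exact hne (hQ _ _ (h3.cons_cons _))
      · simp only [List.cons.injEq] at hr
        exact hy hr.1
    · simp only [List.cons_append, List.nil_append, List.cons.injEq] at e
      obtain ⟨rfl, rfl⟩ := e
      exact hPQ y (h1.subset (by simp)) (h2.subset (by simp))
    · simp only [List.cons_append, List.cons.injEq] at e
      obtain ⟨rfl, rfl, -⟩ := e
      exact hnil (h1.subset (by simp))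

theorem NoncrossingLabels.map_cons {L : List (List ℕ)} (h : NoncrossingLabels L) (j : ℕ) :
    NoncrossingLabels (L.map (j :: ·)) := by
  intro x y hxy
  obtain ⟨l, hl, e⟩ := List.sublist_map_iff.1 hxy
  rcases l with _ | ⟨b₁, _ | ⟨b₂, _ | ⟨b₃, _ | ⟨b₄, _ | ⟨b₅, l⟩⟩⟩⟩⟩ <;> simp at e
  obtain ⟨rfl, rfl, h3, h4⟩ := e
  simp only [List.cons.injEq, true_and] at h3 h4
  subst h3 h4
  rw [h _ _ hl]

theorem NoncrossingLabels.cons_of_not_mem {Λ : Type*} {L : List Λ} (h : NoncrossingLabels L) {z : Λ}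
    (hz : z ∉ L) : NoncrossingLabels (z :: L) := by
  intro x y hxy
  rcases List.sublist_cons_iff.1 hxy with h' | ⟨r, hr, h'⟩
  · exact h _ _ h'
  · simp only [List.cons.injEq] at hr
    obtain ⟨rfl, rfl⟩ := hr
    exact absurd (h'.subset (by simp)) hz

theorem noncrossingLabels_sectorList (t : PlanarTree) : NoncrossingLabels t.sectorList := by
  induction t using PlanarTree.induction with
  | h ts ih =>
    -- The claim is strengthened by a root label in front, standing for the root sectors already
    -- passed when the later subtrees are treated.
    have key : ∀ j, NoncrossingLabels ([] :: forestSectors j ts) := by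
      induction ts with
      | nil =>
        intro j x y h
        exact absurd h.length_le (by simp [forestSectors])
      | cons t ts iht =>
        intro j
        cases ts with
        | nil =>
          exact ((ih t (by simp)).map_cons j).cons_of_not_mem (by simp)
        | cons s ts =>
          exact noncrossingLabels_append ((ih t (by simp)).map_cons j)
            (iht (fun t ht => ih t (List.mem_cons_of_mem _ ht)) (j + 1))
            fun x hx => not_mem_of_mem_map_cons hx
    rw [sectorList_node]
    exact fun x y h => key 0 x y (h.cons _)

end PlanarTree

/-! ### Evaluation of word functionals along labelled words -/

section LabelEval

variable {A B R Λ : Type*} [CommSemiring R] [DecidableEq Λ]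

/-- The subword of the letters with label `x`. -/
def labelWord (x : Λ) (l : List (Λ × A)) : List A :=
  (l.filter fun p => decide (p.1 = x)).map Prod.snd

theorem labelWord_append (x : Λ) (l l' : List (Λ × A)) :
    labelWord x (l ++ l') = labelWord x l ++ labelWord x l' := by
  simp [labelWord]

theorem labelWord_of_not_mem {x : Λ} {l : List (Λ × A)} (h : x ∉ l.map Prod.fst) :
    labelWord x l = [] := by
  simp only [labelWord, List.map_eq_nil_iff, List.filter_eq_nil_iff, decide_eq_true_eq]
  exact fun p hp e => h (e ▸ List.mem_map_of_mem hp)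

/-- The product of the values of `f` at the subwords of the letters with the same label. -/
def labelEval (f : List A → R) (l : List (Λ × A)) : R :=
  ∏ x ∈ (l.map Prod.fst).toFinset, f (labelWord x l)

theorem labelWord_map {Λ' : Type*} [DecidableEq Λ'] {e : Λ → Λ'} (he : Function.Injective e) (x : Λ)
    (l : List (Λ × A)) : labelWord (e x) (l.map (Prod.map e id)) = labelWord x l := by
  simp [labelWord, List.filter_map, Function.comp_def, he.eq_iff]

theorem labelEval_map {Λ' : Type*} [DecidableEq Λ'] (f : List A → R) {e : Λ → Λ'}
    (he : Function.Injective e) (l : List (Λ × A)) :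
    labelEval f (l.map (Prod.map e id)) = labelEval f l := by
  have : (l.map (Prod.map e id)).map Prod.fst = (l.map Prod.fst).map e := by simp
  have himg : ((l.map Prod.fst).map e).toFinset = (l.map Prod.fst).toFinset.image e := by
    ext; simp
  rw [labelEval, this, himg, Finset.prod_image he.injOn]
  exact Finset.prod_congr rfl fun x _ => by rw [labelWord_map he]

end LabelEval

/-! ### Words attached to tuples and to blocks -/

section BlockWord

variable {A R : Type*}

/-- The word of a function on `Fin m` determines the function. -/
def toWord (F : (m : ℕ) → (Fin m → A) → R) (w : List A) : R := F w.length w.get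

/-- Comparing pairs of a length and a tuple in a sigma type avoids transport along the equality of
lengths. -/
theorem toWord_ofFn (F : (m : ℕ) → (Fin m → A) → R) {m : ℕ} (v : Fin m → A) :
    toWord F (List.ofFn v) = F m v := by
  have := List.equivSigmaTuple.apply_symm_apply (⟨m, v⟩ : Σ n, Fin n → A)
  exact congrArg (fun s : Σ n, Fin n → A => F s.1 s.2) this

/-- The elements of a set of positions, in increasing order. -/
def blockWord {n : ℕ} (V : Finset (Fin n)) : List (Fin n) := (List.finRange n).filter (· ∈ V)

@[simp] theorem mem_blockWord {n : ℕ} {V : Finset (Fin n)} {i : Fin n} : i ∈ blockWord V ↔ i ∈ V := by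
  simp [blockWord]

theorem blockWord_injective {n : ℕ} : Function.Injective (blockWord (n := n)) := by
  intro V W h
  ext i
  rw [← mem_blockWord, h, mem_blockWord]

theorem ofFn_orderEmbOfFin {n : ℕ} (V : Finset (Fin n)) :
    List.ofFn (V.orderEmbOfFin rfl) = blockWord V := by
  rw [List.ofFn_eq_map, Finset.listMap_orderEmbOfFin_finRange]
  refine List.Perm.eq_of_pairwise' (r := (· ≤ ·)) (Finset.pairwise_sort V (· ≤ ·))
    ((List.pairwise_le_finRange n).filter _) ?_
  rw [blockWord, List.perm_ext_iff_of_nodup (Finset.sort_nodup V _) ((List.nodup_finRange n).filter _)]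
  simp

theorem partitionEval_eq_prod {A : Type*} (F : (m : ℕ) → (Fin m → A) → ℂ) {n : ℕ}
    (π : SetPartition n) (a : Fin n → A) :
    partitionEval F π a = ∏ V ∈ π.parts, toWord F ((blockWord V).map a) := by
  refine Finset.prod_congr rfl fun V _ => ?_
  rw [← ofFn_orderEmbOfFin, List.map_ofFn, toWord_ofFn]
  rfl

end BlockWord

/-! ### Products over the internal vertices of a tree -/

section TreeEval

variable {A R : Type*} [CommSemiring R]

/-- The product over the internal vertices of `t` of the values of `f` at the letters in the sectors
of the vertex. -/
def treeEval (f : List A → R) (t : PlanarTree) (w : List A) : R :=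
  labelEval f (t.sectorList.zip w)

/-- The parts of the partition of the sectors of `t` correspond to the labels in `sectorList`. -/
theorem prod_treePartition {n : ℕ} {t : PlanarTree} (ht : t.numLeaves = n + 1)
    (f : List A → R) (a : Fin n → A) :
    ∏ V ∈ (treePartition n t).parts, f ((blockWord V).map a) =
      treeEval f t (List.ofFn a) := by
  classical
  have hlen : t.sectorList.length = n := by
    have := t.length_sectorList
    omega
  obtain ⟨L, hL⟩ : ∃ L, L = t.sectorList := ⟨_, rfl⟩
  rw [← hL] at hlen
  have hget : ∀ i : Fin n, L[(i : ℕ)]? = some (L[(i : ℕ)]'(by omega)) := fun i =>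
    List.getElem?_eq_getElem _
  have hzip : L.zip (List.ofFn a) =
      (List.finRange n).map fun i : Fin n => (L[(i : ℕ)]'(by omega), a i) := by
    apply List.ext_getElem
    · simp [hlen]
    · intro i h1 h2
      simp
  rw [treeEval, labelEval, ← hL, List.map_fst_zip (by simp [hlen])]
  symm
  -- A label corresponds to the set of positions that carry it.
  refine Finset.prod_bij (fun x _ => univ.filter fun i : Fin n => L[(i : ℕ)]? = some x) ?_ ?_ ?_ ?_
  · intro x hx
    obtain ⟨k, hk, rfl⟩ := List.getElem_of_mem (List.mem_toFinset.1 hx)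
    have e : (treePartition n t).part ⟨k, by omega⟩ =
        univ.filter fun i : Fin n => L[(i : ℕ)]? = some L[k] := by
      ext i
      rw [treePartition, Finpartition.mem_part_ofSetoid_iff_rel, Setoid.ker_def, ← hL]
      simp [List.getElem?_eq_getElem hk, eq_comm]
    rw [← e]
    exact (treePartition n t).part_mem.2 (mem_univ _)
  · intro x hx y hy h
    obtain ⟨k, hk, rfl⟩ := List.getElem_of_mem (List.mem_toFinset.1 hx)
    have : (⟨k, by omega⟩ : Fin n) ∈ univ.filter fun i : Fin n => L[(i : ℕ)]? = some y := by
      rw [← h]; simp [List.getElem?_eq_getElem hk]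
    simpa [List.getElem?_eq_getElem hk] using this
  · intro V hV
    obtain ⟨i, hi⟩ := (treePartition n t).nonempty_of_mem_parts hV
    refine ⟨L[(i : ℕ)]'(by omega), List.mem_toFinset.2 (List.getElem_mem _), ?_⟩
    rw [← (treePartition n t).part_eq_of_mem hV hi]
    ext j
    rw [treePartition, Finpartition.mem_part_ofSetoid_iff_rel, Setoid.ker_def, ← hL]
    simp [hget, eq_comm]
  · intro x hx
    congr 1
    rw [hzip, labelWord, blockWord, List.filter_map, List.map_map]
    simp [Function.comp_def, hget]

/-- A crossing `a < b < c < d` would exhibit an alternating sublist `x, y, x, y` of the sector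
labels. -/
theorem treePartition_mem_NC {n : ℕ} {t : PlanarTree} (ht : t.numLeaves = n + 1) :
    treePartition n t ∈ NC n := by
  classical
  have hlen : t.sectorList.length = n := by
    have := t.length_sectorList
    omega
  have hrel : ∀ V ∈ (treePartition n t).parts, ∀ a ∈ V, ∀ b ∈ V,
      t.sectorList[(a : ℕ)]'(by omega) = t.sectorList[(b : ℕ)]'(by omega) := by
    intro V hV a ha b hb
    rw [← (treePartition n t).part_eq_of_mem hV ha, treePartition,
      Finpartition.mem_part_ofSetoid_iff_rel, Setoid.ker_def] at hb
    have h1 : (a : ℕ) < t.sectorList.length := by omega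
    have h2 : (b : ℕ) < t.sectorList.length := by omega
    simpa [List.getElem?_eq_getElem h1, List.getElem?_eq_getElem h2] using hb
  simp only [NC, Finset.mem_filter, Finset.mem_univ, true_and]
  intro V hV W hW a b c d hab hbc hcd ha hc hb hd
  have hs := List.map_getElem_sublist (l := t.sectorList)
    (is := [Fin.cast hlen.symm a, Fin.cast hlen.symm b, Fin.cast hlen.symm c, Fin.cast hlen.symm d])
    (by simp only [List.pairwise_cons, List.mem_cons, Fin.lt_def]; simp; omega)
  simp only [List.map_cons, List.map_nil, Fin.getElem_fin, Fin.val_cast] at hs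
  rw [← hrel V hV a ha c hc, ← hrel W hW b hb d hd] at hs
  have e := t.noncrossingLabels_sectorList _ _ hs
  have : b ∈ (treePartition n t).part a := by
    rw [treePartition, Finpartition.mem_part_ofSetoid_iff_rel, Setoid.ker_def]
    have h1 : (a : ℕ) < t.sectorList.length := by omega
    have h2 : (b : ℕ) < t.sectorList.length := by omega
    simp [List.getElem?_eq_getElem h1, List.getElem?_eq_getElem h2, e]
  rw [(treePartition n t).part_eq_of_mem hV ha] at this
  exact (treePartition n t).eq_of_mem_parts hV hW this hb

/-- The weight of a word along a list of trees grafted to a common root: the letters between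
consecutive trees are fed to `f`, the other ones to the trees. -/
def forestEval (Z : PlanarTree → List A → R) : List PlanarTree → (List A → R) → List A → R
  | [], _, _ => 0
  | [t], f, w => f [] * Z t w
  | t :: s :: ts, f, w =>
    match w.drop t.sectorList.length with
    | [] => 0
    | a :: v => Z t (w.take t.sectorList.length) * forestEval Z (s :: ts) (fun u => f (a :: u)) v

theorem forestEval_mul (c : PlanarTree → R) (Z : PlanarTree → List A → R) {ts : List PlanarTree}
    (f : List A → R) (w : List A) :
    forestEval (fun t v => c t * Z t v) ts f w = (ts.map c).prod * forestEval Z ts f w := by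
  induction ts generalizing f w with
  | nil => simp [forestEval]
  | cons t ts ih =>
    cases ts with
    | nil => simp [forestEval]; ring
    | cons s ts =>
      rw [forestEval, forestEval]
      cases w.drop t.sectorList.length with
      | nil => simp
      | cons a v => simp only [ih, List.map_cons, List.prod_cons]; ring

/-- The root label has its own functional `k`: removing the first tree and the root sector after it
replaces `k` by `k (a :: ·)`, while `f` is unchanged at all other vertices. -/
theorem labelEval_forestSectors (f : List A → R) {ts : List PlanarTree} (hts : ts ≠ []) (j : ℕ)
    (k : List A → R) (w : List A) (hw : w.length = (PlanarTree.forestSectors j ts).length) :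
    k (labelWord [] ((PlanarTree.forestSectors j ts).zip w)) *
      ∏ x ∈ (PlanarTree.forestSectors j ts).toFinset.erase [],
        f (labelWord x ((PlanarTree.forestSectors j ts).zip w)) =
      forestEval (treeEval f) ts k w := by
  have htree : ∀ (j : ℕ) (t : PlanarTree) (v : List A),
      labelEval f ((t.sectorList.map (j :: ·)).zip v) = treeEval f t v := by
    intro j t v
    rw [treeEval, ← labelEval_map f (e := fun l => j :: l) (fun l l' h => by simpa using h)
      (t.sectorList.zip v), ← List.zip_map_left]
  have hroot : ∀ (j : ℕ) (t : PlanarTree) (v : List A),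
      labelWord [] ((t.sectorList.map (j :: ·)).zip v) = [] := by
    intro j t v
    refine labelWord_of_not_mem fun h => ?_
    obtain ⟨⟨x, y⟩, hp, hx⟩ := List.mem_map.1 h
    obtain ⟨h1, _⟩ := List.of_mem_zip hp
    simp only at hx
    subst hx
    simp at h1
  induction ts generalizing j k w with
  | nil => exact absurd rfl hts
  | cons t ts ih =>
    cases ts with
    | nil =>
      simp only [PlanarTree.forestSectors] at hw ⊢
      rw [forestEval, hroot, ← htree, labelEval, List.map_fst_zip hw.ge, Finset.erase_eq_of_notMem]
      simp
    | cons s ts =>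
      rw [PlanarTree.forestSectors] at hw ⊢
      obtain ⟨Q, hQ⟩ : ∃ Q, Q = PlanarTree.forestSectors (j + 1) (s :: ts) := ⟨_, rfl⟩
      have hIH := ih (by simp) (j + 1)
      rw [← hQ] at hw ⊢ hIH
      obtain ⟨m, hm⟩ : ∃ m, m = t.sectorList.length := ⟨_, rfl⟩
      simp only [List.length_append, List.length_map, List.length_cons, ← hm] at hw
      obtain ⟨a, v, hav⟩ : ∃ a v, w.drop m = a :: v := by
        cases h : w.drop m with
        | nil => simp at h; omega
        | cons a v => exact ⟨a, v, rfl⟩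
      have hv : v.length = Q.length := by
        have := congrArg List.length hav
        simp at this
        omega
      have hww : w = w.take m ++ a :: v := by rw [← hav, List.take_append_drop]
      have htk : (w.take m).length = m := by simp; omega
      obtain ⟨u, hu⟩ : ∃ u, u = w.take m := ⟨_, rfl⟩
      rw [forestEval, ← hm, hav]
      dsimp only
      rw [← hu] at hww htk ⊢
      have hz : (t.sectorList.map (j :: ·) ++ [] :: Q).zip w =
          (t.sectorList.map (j :: ·)).zip u ++ ([], a) :: Q.zip v := by
        rw [hww, List.zip_append (by simp [htk, ← hm])]
        rfl
      obtain ⟨P, hP⟩ : ∃ P, P = t.sectorList.map (j :: ·) := ⟨_, rfl⟩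
      have hPl : P.length = u.length := by rw [hP, htk, hm]; simp
      have hPQ : ∀ x ∈ P, x ∉ [] :: Q := by
        intro x hx
        rw [hQ]
        exact PlanarTree.not_mem_of_mem_map_cons (hP ▸ hx)
      rw [hz, ← htree j t u, ← hP]
      have hr : labelWord [] (P.zip u ++ ([], a) :: Q.zip v) = a :: labelWord [] (Q.zip v) := by
        rw [labelWord_append, hP, hroot]
        simp [labelWord]
      have hset : (P ++ [] :: Q).toFinset.erase [] = P.toFinset ∪ Q.toFinset.erase [] := by
        ext x
        have : x ∈ P → x ≠ [] := fun h e => hPQ x h (by simp [e])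
        simp only [Finset.mem_erase, List.mem_toFinset, List.mem_append, List.mem_cons,
          Finset.mem_union]
        tauto
      have hd : Disjoint P.toFinset (Q.toFinset.erase []) := by
        refine Finset.disjoint_left.2 fun x hx hx' => hPQ x (List.mem_toFinset.1 hx) ?_
        exact List.mem_cons_of_mem _ (List.mem_toFinset.1 (Finset.mem_of_mem_erase hx'))
      rw [hr, hset, Finset.prod_union hd, ← hIH (fun u => k (a :: u)) v hv]
      have e1 : ∏ x ∈ P.toFinset, f (labelWord x (P.zip u ++ ([], a) :: Q.zip v)) =
          labelEval f (P.zip u) := by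
        rw [labelEval, List.map_fst_zip hPl.le]
        refine Finset.prod_congr rfl fun x hx => ?_
        rw [labelWord_append, labelWord_of_not_mem (l := ([], a) :: Q.zip v), List.append_nil]
        rw [List.map_cons, List.map_fst_zip hv.ge]
        exact hPQ x (List.mem_toFinset.1 hx)
      have e2 : ∏ x ∈ Q.toFinset.erase [], f (labelWord x (P.zip u ++ ([], a) :: Q.zip v)) =
          ∏ x ∈ Q.toFinset.erase [], f (labelWord x (Q.zip v)) := by
        refine Finset.prod_congr rfl fun x hx => ?_
        have hx' := Finset.mem_erase.1 hx
        have hne : ¬ [] = x := fun e => hx'.1 e.symm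
        rw [labelWord_append, labelWord_of_not_mem (l := P.zip u), List.nil_append]
        · simp [labelWord, hne]
        · rw [List.map_fst_zip hPl.le]
          exact fun h => hPQ x h (List.mem_cons_of_mem _ (List.mem_toFinset.1 hx'.2))
      rw [e1, e2]
      ring

theorem treeEval_node (f : List A → R) {ts : List PlanarTree} (hts : 2 ≤ ts.length) (w : List A)
    (hw : w.length + 1 = (PlanarTree.node ts).numLeaves) :
    treeEval f (PlanarTree.node ts) w = forestEval (treeEval f) ts f w := by
  have hlen := (PlanarTree.node ts).length_sectorList
  rw [PlanarTree.sectorList_node] at hlen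
  have hw' : w.length = (PlanarTree.forestSectors 0 ts).length := by omega
  -- Two children give the root at least one sector; with a single child the root would contribute
  -- no label and the identity would miss a factor `f []`.
  have hmem : [] ∈ (PlanarTree.forestSectors 0 ts).toFinset := by
    match ts, hts with
    | t :: s :: ts, _ => simp [PlanarTree.forestSectors]
  rw [← labelEval_forestSectors f (by rintro rfl; simp at hts) 0 f w hw', treeEval, labelEval,
    PlanarTree.sectorList_node, List.map_fst_zip hw'.ge, Finset.mul_prod_erase _
      (fun x => f (labelWord x ((PlanarTree.forestSectors 0 ts).zip w))) hmem]

theorem treeEval_leaf (f : List A → R) (w : List A) : treeEval f (PlanarTree.node []) w = 1 := by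
  simp [treeEval, labelEval, PlanarTree.sectorList_node, PlanarTree.forestSectors]

end TreeEval

/-! ### Sums over Schröder trees -/

theorem mem_ST {n : ℕ} {t : PlanarTree} : t ∈ ST n ↔ t.IsSchroeder ∧ t.numLeaves = n + 1 := by
  simp [ST]

open Classical in
/-- The nonempty lists of Schröder trees with `n + 1` leaves in total. -/
noncomputable def schroederForests (n : ℕ) : Finset (List PlanarTree) :=
  (ST n).image (fun t => [t]) ∪ Finset.univ.biUnion fun i : Fin n =>
    (ST i ×ˢ schroederForests (n - (i + 1))).image fun p => p.1 :: p.2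
termination_by n
decreasing_by omega

theorem mem_schroederForests {n : ℕ} {ts : List PlanarTree} :
    ts ∈ schroederForests n ↔
      ts ≠ [] ∧ (∀ t ∈ ts, t.IsSchroeder) ∧ (ts.map PlanarTree.numLeaves).sum = n + 1 := by
  induction ts generalizing n with
  | nil => rw [schroederForests]; simp
  | cons t ts ih =>
    have hpos := t.numLeaves_pos
    rw [schroederForests]
    simp only [Finset.mem_union, Finset.mem_image, List.cons.injEq, Finset.mem_biUnion,
      Finset.mem_univ, true_and, Finset.mem_product, Prod.exists, mem_ST]
    constructor
    · rintro (⟨s, ⟨h1, h2⟩, rfl, rfl⟩ | ⟨i, s, ss, ⟨⟨h1, h2⟩, h3⟩, rfl, rfl⟩)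
      · simpa using ⟨h1, h2⟩
      · obtain ⟨h3, h4, h5⟩ := ih.1 h3
        refine ⟨by simp, by simpa using ⟨h1, h4⟩, ?_⟩
        have := i.2
        simp only [List.map_cons, List.sum_cons]
        omega
    · rintro ⟨-, h1, h2⟩
      simp only [List.map_cons, List.sum_cons, List.mem_cons, forall_eq_or_imp] at h1 h2
      by_cases hts : ts = []
      · subst hts
        exact Or.inl ⟨t, ⟨h1.1, by simpa using h2⟩, rfl, rfl⟩
      · have hs : 0 < (ts.map PlanarTree.numLeaves).sum := by
          cases ts with
          | nil => exact absurd rfl hts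
          | cons s ss =>
            have := s.numLeaves_pos
            simp only [List.map_cons, List.sum_cons]
            omega
        refine Or.inr ⟨⟨t.numLeaves - 1, by omega⟩, t, ts, ⟨⟨h1.1, ?_⟩, ih.2 ⟨hts, h1.2, ?_⟩⟩,
          rfl, rfl⟩
        · simp only; omega
        · simp only; omega

theorem sum_schroederForests {R : Type*} [AddCommMonoid R] (n : ℕ) (Q : List PlanarTree → R) :
    ∑ ts ∈ schroederForests n, Q ts = ∑ t ∈ ST n, Q [t] +
      ∑ i : Fin n, ∑ t ∈ ST i, ∑ ts ∈ schroederForests (n - (i + 1)), Q (t :: ts) := by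
  classical
  have hd : Disjoint ((ST n).image fun t => [t]) (Finset.univ.biUnion fun i : Fin n =>
      (ST i ×ˢ schroederForests (n - (i + 1))).image fun p => p.1 :: p.2) := by
    refine Finset.disjoint_left.2 fun ts h1 h2 => ?_
    obtain ⟨t, -, rfl⟩ := Finset.mem_image.1 h1
    simp only [Finset.mem_biUnion, Finset.mem_image, Finset.mem_product, List.cons.injEq] at h2
    obtain ⟨i, -, p, ⟨-, h3⟩, -, h4⟩ := h2
    exact (mem_schroederForests.1 h3).1 h4
  rw [schroederForests]
  refine Eq.trans (by congr!) ((Finset.sum_union hd).trans ?_)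
  rw [Finset.sum_image (by simp), Finset.sum_biUnion]
  · congr 1
    refine Finset.sum_congr rfl fun i _ => ?_
    rw [Finset.sum_image, Finset.sum_product]
    rintro ⟨a, b⟩ - ⟨c, d⟩ - h
    simpa using h
  · intro i _ j _ hij
    refine Finset.disjoint_left.2 fun ts h1 h2 => hij ?_
    simp only [Finset.mem_image, Finset.mem_product] at h1 h2
    obtain ⟨p, ⟨h1, -⟩, rfl⟩ := h1
    obtain ⟨q, ⟨h2, -⟩, e⟩ := h2
    simp only [List.cons.injEq] at e
    have e1 := (mem_ST.1 h1).2
    have e2 := (mem_ST.1 h2).2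
    rw [e.1] at e2
    exact Fin.ext (by omega)

theorem sum_ST {R : Type*} [AddCommMonoid R] {n : ℕ} (hn : n ≠ 0) (Q : PlanarTree → R) :
    ∑ t ∈ ST n, Q t = ∑ ts ∈ (schroederForests n).filter (2 ≤ ·.length), Q (.node ts) := by
  symm
  refine Finset.sum_bij (fun ts _ => .node ts) ?_ ?_ ?_ fun _ _ => rfl
  · intro ts hts
    obtain ⟨h1, h2⟩ := Finset.mem_filter.1 hts
    obtain ⟨h3, h4, h5⟩ := mem_schroederForests.1 h1
    exact mem_ST.2 ⟨.branch ts h2 h4, by rw [PlanarTree.numLeaves_node h3, h5]⟩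
  · intro ts _ ss _ h
    simpa using h
  · intro t ht
    obtain ⟨h1, h2⟩ := mem_ST.1 ht
    cases h1 with
    | leaf => simp [PlanarTree.numLeaves] at h2; exact absurd h2.symm (Ne.symm hn)
    | branch ts hts h =>
      have hne : ts ≠ [] := by rintro rfl; simp at hts
      rw [PlanarTree.numLeaves_node hne] at h2
      exact ⟨ts, Finset.mem_filter.2 ⟨mem_schroederForests.2 ⟨hne, h, h2⟩, hts⟩, rfl⟩

theorem ST_zero : ST 0 = {.node []} := by
  ext t
  rw [mem_ST, Finset.mem_singleton]
  constructor
  · rintro ⟨h1, h2⟩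
    cases h1 with
    | leaf => rfl
    | branch ts hts h =>
      exfalso
      match ts, hts with
      | t :: s :: ts, _ =>
        have h3 := t.numLeaves_pos
        have h4 := s.numLeaves_pos
        rw [PlanarTree.numLeaves_node (by simp)] at h2
        simp only [List.map_cons, List.sum_cons] at h2
        omega
  · rintro rfl
    exact ⟨.leaf, by simp [PlanarTree.numLeaves]⟩

/-! ### From recursions for tree weights to composition equations -/

section

variable {A R : Type*} [CommRing R]

/-- The sum over the Schröder trees with as many sectors as the word has letters, with the weights
`c`. -/
noncomputable def treeSum (c : PlanarTree → R) (f : List A → R) (w : List A) : R :=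
  ∑ t ∈ ST w.length, c t * treeEval f t w

/-- Grafting a list of trees to a root amounts to selecting the letters between consecutive trees
and filling each gap with a tree. Splitting off the first tree matches the expansion at the first
selected letter. -/
theorem sum_forestEval (Z : PlanarTree → List A → R) (f : List A → R) (w : List A) :
    ∑ ts ∈ schroederForests w.length, forestEval Z ts f w =
      wordComp f (fun v => ∑ t ∈ ST v.length, Z t v) w := by
  induction hn : w.length using Nat.strong_induction_on generalizing f w with
  | _ n ih =>
    subst hn
    rw [sum_schroederForests, wordComp, compAux_eq_sum]
    congr 1
    · simp only [forestEval, Finset.mul_sum]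
    · refine Finset.sum_congr rfl fun i _ => ?_
      have hdrop : (w.drop (i + 1)).length = w.length - (i + 1) := by simp
      have htake : (w.take i).length = i := by simp
      rw [← ih (w.drop (i + 1)).length (by rw [hdrop]; omega) _ _ rfl, Finset.sum_mul, hdrop, htake]
      refine Finset.sum_congr rfl fun t ht => ?_
      rw [Finset.mul_sum]
      refine Finset.sum_congr rfl fun ts hts => ?_
      have hl : t.sectorList.length = i := by
        have h1 := t.length_sectorList
        have h2 := (mem_ST.1 ht).2
        omega
      have hne := (mem_schroederForests.1 hts).1
      cases ts with
      | nil => exact absurd rfl hne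
      | cons s ts =>
        rw [forestEval, hl, List.drop_eq_getElem_cons i.2]
        rfl

theorem treeSum_nil (c : PlanarTree → R) (f : List A → R) : treeSum c f [] = c (.node []) := by
  simp [treeSum, ST_zero, treeEval_leaf]

/-- In the composition, the lists of at least two trees are the root decompositions of Schröder
trees and give `treeSum d`; the lists of one tree select no letter and give the term with `f []`.
The derivative of the exponential weights and the increment of the strict map counts both have the
form of `d`. -/
theorem treeSum_add_mul (c d : PlanarTree → R)
    (hd : ∀ ts : List PlanarTree, 2 ≤ ts.length → d (.node ts) = (ts.map c).prod)
    (f : List A → R) {w : List A} (hw : w ≠ []) :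
    treeSum d f w + f [] * treeSum c f w = wordComp f (treeSum c f) w := by
  have hn : w.length ≠ 0 := by simpa using hw
  have h := sum_forestEval (fun t v => c t * treeEval f t v) f w
  change _ = wordComp f (treeSum c f) w at h
  rw [← h, ← Finset.sum_filter_add_sum_filter_not _ (fun ts => 2 ≤ ts.length)]
  congr 1
  · rw [treeSum, sum_ST hn]
    refine Finset.sum_congr rfl fun ts hts => ?_
    obtain ⟨h1, h2⟩ := Finset.mem_filter.1 hts
    obtain ⟨h3, h4, h5⟩ := mem_schroederForests.1 h1
    rw [hd ts h2, treeEval_node f h2 w (by rw [PlanarTree.numLeaves_node h3, h5]), forestEval_mul]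
  · rw [treeSum, Finset.mul_sum]
    refine Finset.sum_bij (fun t _ => [t]) ?_ (by simp) ?_ fun t _ => rfl
    · intro t ht
      simpa [mem_schroederForests] using mem_ST.1 ht
    · intro ts hts
      obtain ⟨h1, h2⟩ := Finset.mem_filter.1 hts
      obtain ⟨h3, h4, h5⟩ := mem_schroederForests.1 h1
      match ts, h3, h2 with
      | [t], _, _ => exact ⟨t, mem_ST.2 ⟨h4 t (by simp), by simpa using h5⟩, rfl⟩
      | t :: s :: ts, _, h2 => simp at h2

end

/-! ### The exponential flow -/

section Flow

open Polynomial PlanarTree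

theorem map_treeEval {A R S : Type*} [CommSemiring R] [CommSemiring S] (ψ : R →+* S)
    (f : List A → R) (t : PlanarTree) (w : List A) :
    ψ (treeEval f t w) = treeEval (fun v => ψ (f v)) t w := by
  simp [treeEval, labelEval]

variable {A K : Type*} [Field K]

/-- The weight `X ^ |s| / s!` with `s` the skeleton of the tree (empty for a leaf). -/
noncomputable def expWeight (t : PlanarTree) : K[X] :=
  if t.children.isEmpty then 1 else C ((t.skeleton.factorial : K)⁻¹) * X ^ t.skeleton.size

theorem expWeight_leaf : expWeight (.node []) = (1 : K[X]) := by simp [expWeight, children]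

theorem expWeight_node {ts : List PlanarTree} (hts : ts ≠ []) :
    (expWeight (.node ts) : K[X]) =
      C (((node ts).skeleton.size : K)⁻¹) * X * (ts.map expWeight).prod := by
  have h : (node ts).skeleton.size = 1 + (((ts.filter fun s => !s.children.isEmpty).map
      skeleton).map size).sum := by rw [skeleton, size]
  have hf : ((node ts).skeleton.factorial : K) = ((node ts).skeleton.size : K) *
      (((ts.filter fun s => !s.children.isEmpty).map fun s => (s.skeleton.factorial : K)).prod) := by
    rw [skeleton, factorial]
    push_cast
    simp [List.map_map, Function.comp_def]
  have key : (ts.map (expWeight (K := K))).prod =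
      C ((((ts.filter fun s => !s.children.isEmpty).map
        fun s => (s.skeleton.factorial : K)).prod)⁻¹) *
      X ^ (((ts.filter fun s => !s.children.isEmpty).map skeleton).map size).sum := by
    clear h hf hts
    induction ts with
    | nil => simp
    | cons t ts ih =>
      rw [List.map_cons, List.prod_cons, ih, expWeight]
      cases h : t.children.isEmpty with
      | true => simp [h]
      | false =>
        simp only [Bool.false_eq_true, ↓reduceIte, h, Bool.not_false, List.filter_cons_of_pos,
          List.map_cons, List.prod_cons, List.sum_cons, mul_inv, map_mul, pow_add]
        ring
  rw [key, expWeight, hf, h]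
  simp only [children, List.isEmpty_iff, hts, ↓reduceIte, mul_inv, map_mul, pow_add, pow_one]
  ring

theorem derivative_expWeight [CharZero K] {ts : List PlanarTree} (hts : ts ≠ []) :
    derivative (expWeight (.node ts) : K[X]) = (ts.map expWeight).prod := by
  have h1 := expWeight_node (K := K) hts
  have hne : ((node ts).skeleton.size : K) ≠ 0 := Nat.cast_ne_zero.2 (size_pos _).ne'
  -- Euler's identity for a monomial: the exponent, which is the size of the skeleton, cancels the
  -- new factor of the tree factorial at the root.
  have h2 : X * derivative (expWeight (.node ts) : K[X]) =
      C ((node ts).skeleton.size : K) * expWeight (.node ts) := by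
    rw [expWeight]
    simp only [children, List.isEmpty_iff, hts, ↓reduceIte, derivative_C_mul, derivative_X_pow]
    obtain ⟨m, hm⟩ := Nat.exists_eq_succ_of_ne_zero (size_pos (node ts).skeleton).ne'
    rw [hm]
    simp only [Nat.succ_eq_add_one, Nat.add_sub_cancel, pow_succ]
    ring
  rw [h1, ← mul_assoc, ← mul_assoc, ← C_mul, mul_inv_cancel₀ hne, C_1, one_mul] at h2
  rw [← h1] at h2
  exact mul_left_cancel₀ X_ne_zero h2

/-- The exponential of `ρ`, as a polynomial in the time parameter. -/
noncomputable def expFlow (ρ : List A → K) (w : List A) : K[X] :=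
  treeSum expWeight (fun v => C (ρ v)) w

/-- This is `treeSum_add_mul` with `d` the derivative of the weights; the one-tree term disappears
because `ρ [] = 0`. -/
theorem derivative_expFlow [CharZero K] {ρ : List A → K} (hρ : ρ [] = 0) (w : List A) :
    derivative (expFlow ρ w) = wordComp (fun v => C (ρ v)) (expFlow ρ) w := by
  by_cases hw : w = []
  · subst hw
    simp [expFlow, treeSum_nil, expWeight_leaf, wordComp, compAux, hρ]
  · have h := treeSum_add_mul (expWeight (K := K)) (fun t => derivative (expWeight t))
      (fun ts hts => derivative_expWeight (by rintro rfl; simp at hts)) (fun v => C (ρ v)) hw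
    have e : (expFlow ρ : List A → K[X]) = treeSum expWeight fun v => C (ρ v) := rfl
    rw [e, ← h]
    simp only [treeSum, derivative_sum, hρ, map_zero, zero_mul, add_zero]
    refine Finset.sum_congr rfl fun t _ => ?_
    rw [← map_treeEval C, mul_comm, derivative_C_mul, mul_comm]

theorem eval_zero_expFlow (ρ : List A → K) (w : List A) : (expFlow ρ w).eval 0 = emptyWord w := by
  by_cases hw : w = []
  · subst hw
    simp [expFlow, treeSum_nil, expWeight_leaf, emptyWord]
  · have hn : w.length ≠ 0 := by simpa using hw
    rw [expFlow, treeSum, eval_finsetSum, emptyWord]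
    simp only [List.isEmpty_iff, hw, ↓reduceIte]
    refine Finset.sum_eq_zero fun t ht => ?_
    rw [eval_mul, expWeight]
    have : t.children ≠ [] := by
      obtain ⟨h1, h2⟩ := mem_ST.1 ht
      cases t with
      | node ts =>
        rintro h
        simp only [children] at h
        subst h
        simp [numLeaves] at h2
        exact hw h2
    simp [this, (size_pos t.skeleton).ne']

theorem eval_one_expFlow (ρ : List A → K) {w : List A} (hw : w ≠ []) :
    (expFlow ρ w).eval 1 =
      ∑ t ∈ ST w.length, (t.skeleton.factorial : K)⁻¹ * treeEval ρ t w := by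
  have hn : w.length ≠ 0 := by simpa using hw
  rw [expFlow, treeSum, eval_finsetSum]
  refine Finset.sum_congr rfl fun t ht => ?_
  have : t.children ≠ [] := by
    obtain ⟨h1, h2⟩ := mem_ST.1 ht
    cases t with
    | node ts =>
      rintro h
      simp only [children] at h
      subst h
      simp [numLeaves] at h2
      exact hw h2
  rw [eval_mul, expWeight, ← map_treeEval C]
  simp [this]

/-- The generator is recovered as the velocity at time `0`, where the flow is the unit for
composition. -/
theorem coeff_one_expFlow [CharZero K] {ρ : List A → K} (hρ : ρ [] = 0) (w : List A) :
    (expFlow ρ w).coeff 1 = ρ w := by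
  have h1 : (derivative (expFlow ρ w)).eval 0 = (expFlow ρ w).coeff 1 := by
    rw [← coeff_zero_eq_eval_zero, coeff_derivative]; simp
  rw [← h1, derivative_expFlow hρ, ← coe_evalRingHom, map_wordComp]
  simp only [coe_evalRingHom, eval_C, eval_zero_expFlow]
  exact congrFun (wordComp_emptyWord_right ρ) w

end Flow

/-! ### The hook formula for the factorial of the forest of nestings -/

section Hook

variable {n : ℕ}

theorem nests_refl (V : Finset (Fin n)) : Nests V V := fun a ha => ⟨⟨a, ha, le_rfl⟩, a, ha, le_rfl⟩

theorem Nests.trans {U V W : Finset (Fin n)} (h : Nests U V) (h' : Nests V W) : Nests U W := by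
  intro a ha
  obtain ⟨⟨x, hx, hxa⟩, y, hy, hay⟩ := h' a ha
  obtain ⟨⟨x', hx', hxx⟩, -⟩ := h x hx
  obtain ⟨-, y', hy', hyy⟩ := h y hy
  exact ⟨⟨x', hx', hxx.trans hxa⟩, y', hy', hay.trans hyy⟩

variable {π : SetPartition n}

theorem Nests.antisymm {V W : Finset (Fin n)} (hV : V ∈ π.parts) (hW : W ∈ π.parts)
    (h : Nests V W) (h' : Nests W V) : V = W := by
  by_contra hne
  exact lt_asymm (min_lt_min_of_strictNests hV hW ⟨h, hne⟩)
    (min_lt_min_of_strictNests hW hV ⟨h', Ne.symm hne⟩)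

/-- In a noncrossing partition a point between two elements of a block `V` that also lies between
two elements of a block `U` forces `U` and `V` to be nested. -/
theorem IsNoncrossing.nests_or_nests (hπ : IsNoncrossing π) {U V W : Finset (Fin n)}
    (hU : U ∈ π.parts) (hV : V ∈ π.parts) (hW : W ∈ π.parts) (h : Nests U W) (h' : Nests V W) :
    Nests U V ∨ Nests V U := by
  -- `U` starts first, and `V` starts before `U` has ended. An element `b` of `V` beyond all of `U`
  -- would give the crossing `u < x < v < b`.
  have key : ∀ U ∈ π.parts, ∀ V ∈ π.parts, ∀ a u v : Fin n, u ∈ U → (∀ x ∈ V, u ≤ x) →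
      v ∈ U → a ≤ v → (∃ x ∈ V, x ≤ a) → Nests U V := by
    rintro U hU V hV a u v hu hux hv hav ⟨x, hx, hxa⟩
    by_cases hUV : U = V
    · exact hUV ▸ nests_refl U
    refine fun b hb => ⟨⟨u, hu, hux b hb⟩, ?_⟩
    by_contra! hlt
    have hne : ∀ {p q : Fin n}, p ∈ U → q ∈ V → p ≠ q := fun hp hq e =>
      hUV (π.eq_of_mem_parts hU hV hp (e ▸ hq))
    exact hUV (hπ U hU V hV u x v b (lt_of_le_of_ne (hux x hx) (hne hu hx))
      (lt_of_le_of_ne (hxa.trans hav) (hne hv hx).symm) (hlt v hv) hu hv hx hb)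
  obtain ⟨a, ha⟩ := π.nonempty_of_mem_parts hW
  obtain ⟨⟨u, hu, hua⟩, u', hu', hua'⟩ := h a ha
  obtain ⟨⟨v, hv, hva⟩, v', hv', hva'⟩ := h' a ha
  have mU := U.min'_mem (π.nonempty_of_mem_parts hU)
  have mV := V.min'_mem (π.nonempty_of_mem_parts hV)
  rcases le_total (U.min' (π.nonempty_of_mem_parts hU)) (V.min' (π.nonempty_of_mem_parts hV))
    with hm | hm
  · exact Or.inl (key U hU V hV a _ u' mU (fun x hx => hm.trans (V.min'_le x hx)) hu' hua' ⟨v, hv, hva⟩)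
  · exact Or.inr (key V hV U hU a _ v' mV (fun x hx => hm.trans (U.min'_le x hx)) hv' hva' ⟨u, hu, hua⟩)

open Classical in
/-- The blocks of `π` nested in `V`, including `V` itself. -/
noncomputable def below (π : SetPartition n) (V : Finset (Fin n)) : Finset (Finset (Fin n)) :=
  π.parts.filter (Nests V)

theorem mem_below {V W : Finset (Fin n)} : W ∈ below π V ↔ W ∈ π.parts ∧ Nests V W := by
  simp [below]

theorem self_mem_below {V : Finset (Fin n)} (hV : V ∈ π.parts) : V ∈ below π V :=
  mem_below.2 ⟨hV, nests_refl V⟩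

open Classical in
/-- The minimal elements of a set of blocks in the nesting order. -/
noncomputable def minimalBlocks (D : Finset (Finset (Fin n))) : Finset (Finset (Fin n)) :=
  D.filter fun V => ∀ U ∈ D, ¬ StrictNests U V

theorem mem_minimalBlocks {D : Finset (Finset (Fin n))} {V : Finset (Fin n)} :
    V ∈ minimalBlocks D ↔ V ∈ D ∧ ∀ U ∈ D, ¬ StrictNests U V := by
  simp [minimalBlocks]

section Decomposition

variable {D : Finset (Finset (Fin n))}

theorem exists_minimalBlock_nests (hD : D ⊆ π.parts) {W : Finset (Fin n)} (hW : W ∈ D) :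
    ∃ V ∈ minimalBlocks D, Nests V W := by
  -- The measure counts the blocks that begin to the left of `W`; it drops on passing to a block
  -- that strictly nests `W`.
  induction hc : #((π.parts).filter fun U => ∃ a ∈ U, ∀ b ∈ W, a < b) using Nat.strong_induction_on
    generalizing W with
  | _ m ih =>
    by_cases h : ∀ U ∈ D, ¬ StrictNests U W
    · exact ⟨W, mem_minimalBlocks.2 ⟨hW, h⟩, nests_refl W⟩
    · push Not at h
      obtain ⟨U, hU, hUW⟩ := h
      have hlt := min_lt_min_of_strictNests (hD hU) (hD hW) hUW
      have hcard : #(π.parts.filter fun T => ∃ a ∈ T, ∀ b ∈ U, a < b) < m := by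
        rw [← hc]
        refine Finset.card_lt_card ((Finset.ssubset_iff_of_subset ?_).2 ⟨U, ?_, ?_⟩)
        · intro T hT
          simp only [Finset.mem_filter] at hT ⊢
          obtain ⟨h1, a, ha, hb⟩ := hT
          exact ⟨h1, a, ha, fun b hbW =>
            (hb _ (U.min'_mem _)).trans (hlt.trans_le (W.min'_le b hbW))⟩
        · simp only [Finset.mem_filter]
          exact ⟨hD hU, _, U.min'_mem _, fun b hb => hlt.trans_le (W.min'_le b hb)⟩
        · simp only [Finset.mem_filter, not_and, not_exists]
          exact fun _ a ha hlt => lt_irrefl _ (hlt a ha)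
      obtain ⟨V, hV, hVU⟩ := ih _ hcard hU rfl
      exact ⟨V, hV, hVU.trans hUW.1⟩

theorem biUnion_minimalBlocks_below (hD : D ⊆ π.parts)
    (hup : ∀ V ∈ D, ∀ W ∈ π.parts, Nests V W → W ∈ D) : (minimalBlocks D).biUnion (below π) = D := by
  ext W
  simp only [Finset.mem_biUnion, mem_below]
  constructor
  · rintro ⟨V, hV, hW, hVW⟩
    exact hup V (mem_minimalBlocks.1 hV).1 W hW hVW
  · intro hW
    obtain ⟨V, hV, hVW⟩ := exists_minimalBlock_nests hD hW
    exact ⟨V, hV, hD hW, hVW⟩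

/-- Here noncrossing makes the nesting order a forest: two blocks above a common block are
comparable, hence equal if both are minimal. -/
theorem pairwiseDisjoint_below (hD : D ⊆ π.parts) (hπ : IsNoncrossing π) :
    (minimalBlocks D : Set (Finset (Fin n))).PairwiseDisjoint (below π) := by
  intro U hU V hV hUV
  refine Finset.disjoint_left.2 fun W hW hW' => ?_
  obtain ⟨hU1, hU2⟩ := mem_minimalBlocks.1 hU
  obtain ⟨hV1, hV2⟩ := mem_minimalBlocks.1 hV
  obtain ⟨hWp, hUW⟩ := mem_below.1 hW
  rcases hπ.nests_or_nests (hD hU1) (hD hV1) hWp hUW (mem_below.1 hW').2 with h | h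
  · exact hV2 U hU1 ⟨h, hUV⟩
  · exact hU2 V hV1 ⟨h, hUV.symm⟩

theorem prod_minimalBlocks {M : Type*} [CommMonoid M] (hD : D ⊆ π.parts)
    (hup : ∀ V ∈ D, ∀ W ∈ π.parts, Nests V W → W ∈ D) (hπ : IsNoncrossing π)
    (f : Finset (Fin n) → M) :
    ∏ V ∈ minimalBlocks D, ∏ W ∈ below π V, f W = ∏ W ∈ D, f W := by
  rw [← Finset.prod_biUnion (pairwiseDisjoint_below hD hπ), biUnion_minimalBlocks_below hD hup]

theorem sum_card_below (hD : D ⊆ π.parts)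
    (hup : ∀ V ∈ D, ∀ W ∈ π.parts, Nests V W → W ∈ D) (hπ : IsNoncrossing π) :
    ∑ V ∈ minimalBlocks D, #(below π V) = #D := by
  rw [← Finset.card_biUnion (pairwiseDisjoint_below hD hπ), biUnion_minimalBlocks_below hD hup]

end Decomposition

theorem nodup_map_val_blockList (π : SetPartition n) : ((blockList π).map Subtype.val).Nodup := by
  rw [blockList, List.map_map]
  refine List.Nodup.map_on ?_ ((List.nodup_finRange n).filter _)
  intro i hi j hj h
  simp only [List.mem_filter, List.mem_finRange, true_and, decide_eq_true_eq] at hi hj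
  simp only [Function.comp_apply] at h
  have h1 : i ∈ π.part j := h ▸ π.mem_part (mem_univ i)
  have h2 : j ∈ π.part i := h ▸ π.mem_part (mem_univ j)
  exact le_antisymm (hi j h2) (hj i h1)

theorem mem_blockList (π : SetPartition n) (V : {V // V ∈ π.parts}) : V ∈ blockList π := by
  obtain ⟨V, hV⟩ := V
  have hm := V.min'_mem (π.nonempty_of_mem_parts hV)
  have he := π.part_eq_of_mem hV hm
  refine List.mem_map.2 ⟨V.min' (π.nonempty_of_mem_parts hV), ?_, Subtype.ext he⟩
  simp only [List.mem_filter, List.mem_finRange, true_and, decide_eq_true_eq, he]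
  exact fun j hj => V.min'_le j hj

/-- A commutative monoid product over the blocks of the list satisfying `p`. -/
theorem prod_map_filter_blockList {M : Type*} [CommMonoid M] (π : SetPartition n)
    (p : Finset (Fin n) → Prop) [DecidablePred p] (f : Finset (Fin n) → M) :
    ((((blockList π).filter fun W => decide (p W.1))).map fun W => f W.1).prod =
      ∏ W ∈ π.parts.filter p, f W := by
  have h1 : ((((blockList π).filter fun W => decide (p W.1))).map Subtype.val).Nodup :=
    (List.filter_sublist.map _).nodup (nodup_map_val_blockList π)
  have h2 : (((blockList π).filter fun W => decide (p W.1)).map Subtype.val).toFinset =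
      π.parts.filter p := by
    ext W
    simp only [List.mem_toFinset, List.mem_map, List.mem_filter, decide_eq_true_eq,
      Finset.mem_filter]
    constructor
    · rintro ⟨V, ⟨-, hV⟩, rfl⟩
      exact ⟨V.2, hV⟩
    · rintro ⟨hW, hp⟩
      exact ⟨⟨W, hW⟩, ⟨mem_blockList π _, hp⟩, rfl⟩
  rw [← h2, List.prod_toFinset _ h1, List.map_map]
  rfl

theorem sum_map_filter_blockList (π : SetPartition n)
    (p : Finset (Fin n) → Prop) [DecidablePred p] (f : Finset (Fin n) → ℕ) :
    ((((blockList π).filter fun W => decide (p W.1))).map fun W => f W.1).sum =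
      ∑ W ∈ π.parts.filter p, f W := by
  have h := prod_map_filter_blockList (M := Multiplicative ℕ) π p fun W => Multiplicative.ofAdd (f W)
  rw [← ofAdd_sum] at h
  apply Multiplicative.ofAdd.injective
  rw [← h, ofAdd_list_prod, List.map_map]
  rfl

/-- The blocks covered by `V` are the minimal ones among those strictly inside `V`, and the sets
below them partition the latter. So sizes add up and factorials multiply, which turns the recursive
tree factorial into a product of hook lengths. -/
theorem size_factorial_nestingTree (hπ : IsNoncrossing π) (V : {V // V ∈ π.parts}) :
    (nestingTree π V).size = #(below π V.1) ∧
      (nestingTree π V).factorial = ∏ W ∈ below π V.1, #(below π W) := by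
  classical
  induction hc : #(below π V.1) using Nat.strong_induction_on generalizing V with
  | _ m ih =>
    obtain ⟨V, hV⟩ := V
    obtain ⟨D, hDdef⟩ : ∃ D, D = (below π V).erase V := ⟨_, rfl⟩
    have hmem : ∀ {W}, W ∈ D ↔ W ∈ π.parts ∧ StrictNests V W := by
      intro W
      rw [hDdef, Finset.mem_erase, mem_below, StrictNests]
      exact ⟨fun h => ⟨h.2.1, h.2.2, h.1.symm⟩, fun h => ⟨h.2.2.symm, h.1, h.2.1⟩⟩
    have hD : D ⊆ π.parts := fun W hW => (hmem.1 hW).1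
    have hup : ∀ U ∈ D, ∀ W ∈ π.parts, Nests U W → W ∈ D := by
      intro U hU W hW hUW
      obtain ⟨hU1, hU2, hU3⟩ := hmem.1 hU
      refine hmem.2 ⟨hW, hU2.trans hUW, ?_⟩
      rintro rfl
      exact hU3 (hU2.antisymm hV hU1 hUW)
    have hmin : π.parts.filter (Covers π V) = minimalBlocks D := by
      ext W
      simp only [Finset.mem_filter, mem_minimalBlocks, hmem, Covers]
      constructor
      · rintro ⟨h1, h2, h3⟩
        exact ⟨⟨h1, h2⟩, fun U hU h => h3 U hU.1 ⟨hU.2, h⟩⟩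
      · rintro ⟨⟨h1, h2⟩, h3⟩
        exact ⟨h1, h2, fun U hU h => h3 U ⟨hU, h.1⟩ h.2⟩
    have hIH : ∀ W ∈ (blockList π).filter (fun W => decide (Covers π V W.1)),
        (nestingTree π W).size = #(below π W.1) ∧
        (nestingTree π W).factorial = ∏ U ∈ below π W.1, #(below π U) := by
      intro W hW
      have hcov : Covers π V W.1 := of_decide_eq_true (List.mem_filter.1 hW).2
      refine ih _ (hc ▸ Finset.card_lt_card ?_) W rfl
      refine Finset.ssubset_iff_of_subset ?_ |>.2 ⟨V, self_mem_below hV, ?_⟩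
      · intro U hU
        obtain ⟨h1, h2⟩ := mem_below.1 hU
        exact mem_below.2 ⟨h1, hcov.1.1.trans h2⟩
      · intro h
        exact hcov.1.2 (hcov.1.1.antisymm hV W.2 (mem_below.1 h).2)
    have htree : nestingTree π ⟨V, hV⟩ = .node (((blockList π).filter
        fun W => decide (Covers π V W.1)).map (nestingTree π)) := by
      rw [nestingTree]
      congr 1
      exact List.attach_map_val (f := nestingTree π)
    have hsize : (nestingTree π ⟨V, hV⟩).size = #(below π V) := by
      rw [htree, PlanarTree.size, List.map_map,
        List.map_congr_left (g := fun W => #(below π W.1)) (f := PlanarTree.size ∘ nestingTree π)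
          fun W hW => (hIH W hW).1,
        sum_map_filter_blockList π (Covers π V) fun W => #(below π W), hmin,
        sum_card_below hD hup hπ, hDdef, Finset.card_erase_of_mem (self_mem_below hV)]
      have := Finset.card_pos.2 ⟨V, self_mem_below hV⟩
      omega
    refine ⟨hsize.trans hc, ?_⟩
    rw [← Finset.mul_prod_erase _ _ (self_mem_below hV), ← hDdef, ← prod_minimalBlocks hD hup hπ,
      ← hmin, ← prod_map_filter_blockList π (Covers π V) fun W => ∏ U ∈ below π W, #(below π U),
      ← hsize, htree, PlanarTree.factorial, List.map_map]
    congr 2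
    exact List.map_congr_left fun W hW => (hIH W hW).2

theorem nestingFactorial_eq_prod (hπ : IsNoncrossing π) :
    nestingFactorial π = ∏ V ∈ π.parts, #(below π V) := by
  classical
  have hmin : π.parts.filter (IsOuter π) = minimalBlocks π.parts := by
    ext W
    simp only [Finset.mem_filter, mem_minimalBlocks, IsOuter]
  rw [nestingFactorial, nestingForest, List.map_map,
    List.map_congr_left (g := fun W => ∏ U ∈ below π W.1, #(below π U))
      (f := PlanarTree.factorial ∘ nestingTree π) fun W hW => (size_factorial_nestingTree hπ W).2,
    prod_map_filter_blockList π (IsOuter π) fun W => ∏ U ∈ below π W, #(below π U), hmin,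
    prod_minimalBlocks subset_rfl (fun _ _ _ h _ => h) hπ]

end Hook

/-! ### Composition with an indicator -/

section Gaps

variable {A R : Type*}

/-- A piece of a list split at the elements satisfying `p` is a maximal run without such elements. -/
theorem splitOnP_spec_of_cons (p : A → Bool) (u : List A) :
    ∃ J Js, u.splitOnP p = J :: Js ∧ (∀ x ∈ J, ¬ p x) ∧
      (∃ post, u = J ++ post ∧ (post = [] ∨ ∃ y post', post = y :: post' ∧ p y)) ∧
      ∀ J' ∈ Js, (∀ x ∈ J', ¬ p x) ∧ ∃ pre y post, u = pre ++ y :: (J' ++ post) ∧ p y ∧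
        (post = [] ∨ ∃ z post', post = z :: post' ∧ p z) := by
  induction u with
  | nil => exact ⟨[], [], by simp, by simp, ⟨[], by simp⟩, by simp⟩
  | cons a u ih =>
    obtain ⟨J, Js, h1, h2, ⟨post, h3, h4⟩, h5⟩ := ih
    rw [List.splitOnP_cons_eq_if_modifyHead, h1]
    by_cases ha : p a
    · refine ⟨[], J :: Js, by simp [ha], by simp, ⟨a :: u, rfl, Or.inr ⟨a, u, rfl, ha⟩⟩, ?_⟩
      intro J' hJ'
      rcases List.mem_cons.1 hJ' with rfl | hJ'
      · exact ⟨h2, [], a, post, by simp [h3], ha, h4⟩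
      · obtain ⟨h6, pre, y, post', h7, h8⟩ := h5 J' hJ'
        exact ⟨h6, a :: pre, y, post', by simp [h7], h8⟩
    · refine ⟨a :: J, Js, by simp [ha], ?_, ⟨post, by simp [h3], h4⟩, ?_⟩
      · intro x hx
        rcases List.mem_cons.1 hx with rfl | hx
        · exact ha
        · exact h2 x hx
      · intro J' hJ'
        obtain ⟨h6, pre, y, post', h7, h8⟩ := h5 J' hJ'
        exact ⟨h6, a :: pre, y, post', by simp [h7], h8⟩

theorem exists_of_mem_splitOnP {p : A → Bool} {u J : List A} (hJ : J ∈ u.splitOnP p) :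
    (∀ x ∈ J, ¬ p x) ∧ ∃ pre post, u = pre ++ J ++ post ∧
      (pre = [] ∨ ∃ pre' y, pre = pre' ++ [y] ∧ p y) ∧
      (post = [] ∨ ∃ z post', post = z :: post' ∧ p z) := by
  obtain ⟨J₀, Js, h1, h2, ⟨post, h3, h4⟩, h5⟩ := splitOnP_spec_of_cons p u
  rw [h1] at hJ
  rcases List.mem_cons.1 hJ with rfl | hJ
  · exact ⟨h2, [], post, by simp [h3], Or.inl rfl, h4⟩
  · obtain ⟨h6, pre, y, post', h7, h8, h9⟩ := h5 J hJ
    exact ⟨h6, pre ++ [y], post', by simp [h7], Or.inr ⟨pre, y, rfl, h8⟩, h9⟩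

theorem exists_mem_splitOnP {p : A → Bool} {u : List A} {x : A} (hx : x ∈ u) (hp : ¬ p x) :
    ∃ J ∈ u.splitOnP p, x ∈ J := by
  induction u with
  | nil => simp at hx
  | cons a u ih =>
    rw [List.splitOnP_cons_eq_if_modifyHead]
    obtain ⟨J₀, Js, h1, -⟩ := splitOnP_spec_of_cons p u
    rw [h1] at ih ⊢
    by_cases ha : p a
    · have : x ∈ u := by
        rcases List.mem_cons.1 hx with rfl | h
        · exact absurd ha hp
        · exact h
      obtain ⟨J, hJ, hxJ⟩ := ih this
      exact ⟨J, by simp only [ha, ↓reduceIte]; exact List.mem_cons_of_mem _ hJ, hxJ⟩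
    · simp only [ha, Bool.false_eq_true, ↓reduceIte, List.modifyHead_cons]
      rcases List.mem_cons.1 hx with rfl | h
      · exact ⟨_, List.mem_cons_self, by simp⟩
      · obtain ⟨J, hJ, hxJ⟩ := ih h
        rcases List.mem_cons.1 hJ with rfl | hJ
        · exact ⟨_, List.mem_cons_self, by simp [hxJ]⟩
        · exact ⟨J, List.mem_cons_of_mem _ hJ, hxJ⟩

variable [CommSemiring R]

theorem prod_map_splitOnP (p : A → Bool) (m : A → R) (u : List A) :
    ((u.splitOnP p).map fun J => (J.map m).prod).prod =
      ((u.filter fun x => !p x).map m).prod := by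
  induction u with
  | nil => simp
  | cons a u ih =>
    rw [List.splitOnP_cons_eq_if_modifyHead]
    obtain ⟨J₀, Js, h1, -⟩ := splitOnP_spec_of_cons p u
    rw [h1] at ih ⊢
    by_cases ha : p a
    · simpa [ha] using ih
    · simp only [List.map_cons, List.prod_cons] at ih
      simp [ha, ← ih, mul_assoc]

/-- Composition with the indicator of a word `v` only sees the occurrence of `v` as the subword of
the letters satisfying `p`, provided that this subword is not longer than `v`. -/
theorem compAux_single [DecidableEq A] (p : A → Bool) (G : List A → R) (u v : List A)
    (g : List A → R) (hv : ∀ a ∈ v, p a) (hlen : (u.filter p).length ≤ v.length) :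
    compAux G u (fun x => if x = v then 1 else 0) g =
      if u.filter p = v then
        g ((u.splitOnP p).headI) * (((u.splitOnP p).tail).map G).prod
      else 0 := by
  induction u generalizing v g with
  | nil => simp [compAux]
  | cons a u ih =>
    obtain ⟨J₀, Js, h1, -⟩ := splitOnP_spec_of_cons p u
    rw [List.splitOnP_cons_eq_if_modifyHead, h1, compAux]
    rw [h1] at ih
    by_cases ha : p a
    · simp only [ha, List.filter_cons_of_pos, List.length_cons] at hlen
      -- The length bound leaves no room to skip `a`: the remaining letters satisfying `p` are too
      -- few to form `v`.
      have hne : u.filter p ≠ v := by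
        intro h
        rw [h] at hlen
        omega
      rw [ih v _ hv (by omega), if_neg hne]
      match v, hv, hlen with
      | b :: v, hv, hlen =>
        have hlen' : (u.filter p).length ≤ v.length := by simpa using hlen
        by_cases hab : a = b
        · subst hab
          simp only [List.cons.injEq, true_and]
          rw [ih v _ (fun x hx => hv x (List.mem_cons_of_mem _ hx)) hlen']
          simp [ha]
        · simp [hab, compAux_zero_left, ha]
    · have hav : ∀ w : List A, a :: w ≠ v := by
        rintro w rfl
        exact ha (hv a (by simp))
      have hf : (a :: u).filter p = u.filter p := by simp [ha]
      rw [hf] at hlen ⊢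
      simp only [hav, ↓reduceIte, compAux_zero_left, mul_zero, add_zero]
      rw [ih v _ hv hlen]
      simp [ha]

theorem wordComp_single [DecidableEq A] (p : A → Bool) (G : List A → R) (u v : List A)
    (hv : ∀ a ∈ v, p a) (hlen : (u.filter p).length ≤ v.length) :
    wordComp (fun x => if x = v then 1 else 0) G u =
      if u.filter p = v then ((u.splitOnP p).map G).prod else 0 := by
  rw [wordComp, compAux_single p G u v G hv hlen]
  obtain ⟨J₀, Js, h1, -⟩ := splitOnP_spec_of_cons p u
  simp [h1]

open Classical in
theorem prod_map_ite_zero {ι : Type*} (l : List ι) (P : ι → Prop) (f : ι → R) :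
    (l.map fun i => if P i then f i else 0).prod =
      if ∀ i ∈ l, P i then (l.map f).prod else 0 := by
  induction l with
  | nil => simp
  | cons a l ih =>
    by_cases ha : P a <;> by_cases hl : ∀ i ∈ l, P i <;> simp [ih, ha, hl]

end Gaps

/-! ### The Schröder trees with a given partition -/

section Fiber

open Polynomial

variable {n : ℕ} {π : SetPartition n}

/-- The word contains with every letter all letters of the block of this letter. -/
def IsBlockClosed (π : SetPartition n) (u : List (Fin n)) : Prop :=
  ∀ i ∈ u, ∀ j ∈ π.part i, j ∈ u

theorem pairwise_lt_of_infix {u : List (Fin n)} (hu : u <:+: List.finRange n) :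
    u.Pairwise (· < ·) :=
  (List.pairwise_lt_finRange n).sublist hu.sublist

theorem mem_of_infix_of_between {u : List (Fin n)} (hu : u <:+: List.finRange n) {a b c : Fin n}
    (ha : a ∈ u) (hc : c ∈ u) (hab : a ≤ b) (hbc : b ≤ c) : b ∈ u := by
  obtain ⟨s, t, h⟩ := hu
  have hs := List.pairwise_lt_finRange n
  rw [← h, List.append_assoc, List.pairwise_append, List.pairwise_append] at hs
  have hb := List.mem_finRange b
  rw [← h] at hb
  simp only [List.mem_append] at hb hs
  rcases hb with (hb | hb) | hb
  · exact absurd (hs.2.2 b hb a (Or.inl ha)) (not_lt.2 hab)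
  · exact hb
  · exact absurd (hs.2.1.2.2 c hc b hb) (not_lt.2 hbc)

open Classical in
/-- The blocks of `π` contained in the word `u`. -/
noncomputable def blocksIn (π : SetPartition n) (u : List (Fin n)) : Finset (Finset (Fin n)) :=
  π.parts.filter (· ⊆ u.toFinset)

theorem mem_blocksIn {u : List (Fin n)} {V : Finset (Fin n)} :
    V ∈ blocksIn π u ↔ V ∈ π.parts ∧ ∀ i ∈ V, i ∈ u := by
  simp [blocksIn, Finset.subset_iff]

/-- A block strictly nesting `V` has elements on both sides of an element of `V`, so no gap can
contain it. Conversely a block that meets a gap and leaves it passes over an element of `V`, and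
then noncrossing forces it to nest `V` strictly, against minimality. Thus the blocks that can be
placed at the root of a tree over `π` are the minimal ones. -/
theorem forall_isBlockClosed_iff (hπ : IsNoncrossing π) {u : List (Fin n)}
    (hu : u <:+: List.finRange n) {V : Finset (Fin n)} (hV : V ∈ blocksIn π u) :
    (∀ J ∈ u.splitOnP (· ∈ V), IsBlockClosed π J) ↔
      IsBlockClosed π u ∧ V ∈ minimalBlocks (blocksIn π u) := by
  obtain ⟨hVp, hVu⟩ := mem_blocksIn.1 hV
  have hpart : ∀ {i W}, W ∈ π.parts → i ∈ W → π.part i = W := fun hW hi => π.part_eq_of_mem hW hi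
  constructor
  · intro h
    refine ⟨?_, mem_minimalBlocks.2 ⟨hV, ?_⟩⟩
    · intro i hi j hj
      by_cases hiV : i ∈ V
      · rw [hpart hVp hiV] at hj
        exact hVu j hj
      · obtain ⟨J, hJ, hiJ⟩ := exists_mem_splitOnP (p := fun x => decide (x ∈ V)) hi (by simpa using hiV)
        obtain ⟨-, pre, post, e, -⟩ := exists_of_mem_splitOnP hJ
        rw [e]
        simp [h J hJ i hiJ j hj]
    · rintro U hU ⟨hUV, hne⟩
      obtain ⟨hUp, hUu⟩ := mem_blocksIn.1 hU
      obtain ⟨v, hv⟩ := π.nonempty_of_mem_parts hVp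
      obtain ⟨⟨x, hx, hxv⟩, y, hy, hvy⟩ := hUV v hv
      have hxV : x ∉ V := fun hxV => hne (π.eq_of_mem_parts hUp hVp hx hxV)
      obtain ⟨J, hJ, hxJ⟩ := exists_mem_splitOnP (p := fun i => decide (i ∈ V)) (hUu x hx)
        (by simpa using hxV)
      obtain ⟨hJV, pre, post, e, -⟩ := exists_of_mem_splitOnP hJ
      have hJu : J <:+: u := ⟨pre, post, e.symm⟩
      have hyJ := h J hJ x hxJ y (by rwa [hpart hUp hx])
      exact hJV v (mem_of_infix_of_between (hJu.trans hu) hxJ hyJ hxv hvy) (by simpa using hv)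
  · rintro ⟨hc, hmin⟩ J hJ i hiJ j hj
    obtain ⟨hJV, pre, post, e, hpre, hpost⟩ := exists_of_mem_splitOnP hJ
    have hiu : i ∈ u := by rw [e]; simp [hiJ]
    have hju := hc i hiu j hj
    have hiV : i ∉ V := by simpa using hJV i hiJ
    by_contra hjJ
    have hs := pairwise_lt_of_infix hu
    rw [e, List.append_assoc, List.pairwise_append, List.pairwise_append] at hs
    simp only [List.mem_append] at hs
    obtain ⟨W, hW⟩ : ∃ W, W = π.part i := ⟨_, rfl⟩
    have hWp : W ∈ π.parts := hW ▸ π.part_mem.2 (mem_univ i)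
    have hiW : i ∈ W := hW ▸ π.mem_part (mem_univ i)
    rw [← hW] at hj
    have hWu : W ∈ blocksIn π u := mem_blocksIn.2 ⟨hWp, fun k hk => hc i hiu k (hW ▸ hk)⟩
    have hVW : V ≠ W := by rintro rfl; exact hiV hiW
    have hjV : j ∉ V := fun h => hVW (π.eq_of_mem_parts hVp hWp h hj)
    -- an element of `V` between two elements of `W`
    obtain ⟨k, hk, l, hl, v, hv, hkv, hvl⟩ : ∃ k ∈ W, ∃ l ∈ W, ∃ v ∈ V, k < v ∧ v < l := by
      rw [e] at hju
      simp only [List.mem_append] at hju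
      rcases hju with (hjp | hj') | hjp
      · rcases hpre with rfl | ⟨pre', y, rfl, hy⟩
        · simp at hjp
        · have hyV : y ∈ V := by simpa using hy
          refine ⟨j, hj, i, hiW, y, hyV, ?_, hs.2.2 y (by simp) i (Or.inl hiJ)⟩
          have h1 := hs.1
          rw [List.pairwise_append] at h1
          rcases List.mem_append.1 hjp with h | h
          · exact h1.2.2 j h y (by simp)
          · simp only [List.mem_singleton] at h
            exact absurd (h ▸ hyV) hjV
      · exact absurd hj' hjJ
      · rcases hpost with rfl | ⟨z, post', rfl, hz⟩
        · simp at hjp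
        · have hzV : z ∈ V := by simpa using hz
          refine ⟨i, hiW, j, hj, z, hzV, hs.2.1.2.2 i hiJ z (by simp), ?_⟩
          rcases List.mem_cons.1 hjp with h | h
          · exact absurd (h ▸ hzV) hjV
          · exact (List.pairwise_cons.1 hs.2.1.2.1).1 j h
    refine (mem_minimalBlocks.1 hmin).2 W hWu ⟨fun b hb => ⟨?_, ?_⟩, hVW.symm⟩
    · by_contra! hlt
      exact hVW (hπ V hVp W hWp b k v l (hlt k hk) hkv hvl hb hv hk hl)
    · by_contra! hlt
      exact hVW (hπ W hWp V hVp k v l b hkv hvl (hlt l hl) hk hl hv hb).symm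

variable {K : Type*} [Field K]

/-- The indicator of the words formed by the blocks of `π`. -/
def blockIndicator (K : Type*) [Field K] (π : SetPartition n) (w : List (Fin n)) : K :=
  ∑ V ∈ π.parts, if w = blockWord V then 1 else 0

theorem blockIndicator_nil : blockIndicator K π [] = 0 := by
  refine Finset.sum_eq_zero fun V hV => if_neg fun h => ?_
  obtain ⟨i, hi⟩ := π.nonempty_of_mem_parts hV
  rw [← mem_blockWord, ← h] at hi
  simp at hi

theorem blockIndicator_blockWord (V : Finset (Fin n)) :
    blockIndicator K π (blockWord V) = if V ∈ π.parts then 1 else 0 := by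
  simp [blockIndicator, blockWord_injective.eq_iff]

/-- The product is nonzero only if every block of the tree partition is a block of `π`, and two
partitions of the same set with this inclusion coincide. -/
theorem treeEval_blockIndicator {t : PlanarTree} (ht : t.numLeaves = n + 1)
    [Decidable (treePartition n t = π)] :
    treeEval (blockIndicator K π) t (List.finRange n) = if treePartition n t = π then 1 else 0 := by
  have h := prod_treePartition ht (blockIndicator K π) id
  rw [List.ofFn_id] at h
  rw [← h]
  simp only [List.map_id, blockIndicator_blockWord]
  split_ifs with he
  · subst he
    exact Finset.prod_eq_one fun V hV => if_pos hV
  · by_contra hne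
    refine he ?_
    have hsub : (treePartition n t).parts ⊆ π.parts := by
      intro V hV
      by_contra hVπ
      exact hne (Finset.prod_eq_zero hV (if_neg hVπ))
    refine Finpartition.ext (hsub.antisymm fun W hW => ?_)
    obtain ⟨i, hi⟩ := π.nonempty_of_mem_parts hW
    have h1 : (treePartition n t).part i ∈ (treePartition n t).parts :=
      (treePartition n t).part_mem.2 (mem_univ i)
    rwa [π.eq_of_mem_parts hW (hsub h1) hi ((treePartition n t).mem_part (mem_univ i))]

/-- The weight `X / #(below π V)` of a block `V`, attached to its minimal element. -/
noncomputable def minWeight (K : Type*) [Field K] (π : SetPartition n) (i : Fin n) : K[X] :=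
  if ∀ j ∈ π.part i, i ≤ j then C ((#(below π (π.part i)) : K)⁻¹) * X else 1

/-- Charging the weight of a block to a single letter makes the total weight a product over letters,
so that it factors over the gaps left by a block. -/
theorem prod_minWeight {V : Finset (Fin n)} (hV : V ∈ π.parts) :
    ∏ i ∈ V, minWeight K π i = C ((#(below π V) : K)⁻¹) * X := by
  have hm := V.min'_mem (π.nonempty_of_mem_parts hV)
  rw [Finset.prod_eq_single_of_mem _ hm, minWeight, π.part_eq_of_mem hV hm, if_pos]
  · exact fun j hj => V.min'_le j hj
  · intro i hi hne
    rw [minWeight, π.part_eq_of_mem hV hi, if_neg]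
    exact fun h => hne (le_antisymm (h _ hm) (V.min'_le i hi))

theorem prod_map_minWeight {u : List (Fin n)} (hu : u.Nodup) (hc : IsBlockClosed π u) :
    (u.map (minWeight K π)).prod = ∏ V ∈ blocksIn π u, (C ((#(below π V) : K)⁻¹) * X) := by
  have h1 : u.toFinset = (blocksIn π u).biUnion id := by
    ext i
    simp only [List.mem_toFinset, Finset.mem_biUnion, id, mem_blocksIn]
    exact ⟨fun hi => ⟨π.part i, ⟨π.part_mem.2 (mem_univ i), hc i hi⟩, π.mem_part (mem_univ i)⟩,
      fun ⟨V, ⟨_, h⟩, hi⟩ => h i hi⟩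
  rw [← List.prod_toFinset _ hu, h1, Finset.prod_biUnion]
  · exact Finset.prod_congr rfl fun V hV => prod_minWeight (mem_blocksIn.1 hV).1
  · exact fun V hV W hW h => π.disjoint (mem_blocksIn.1 hV).1 (mem_blocksIn.1 hW).1 h

theorem prod_map_filter_minWeight {u : List (Fin n)} (hu : u.Nodup) {V : Finset (Fin n)}
    (hV : V ∈ blocksIn π u) :
    C ((#(below π V) : K)⁻¹) * X * ((u.filter fun x => !decide (x ∈ V)).map (minWeight K π)).prod =
      (u.map (minWeight K π)).prod := by
  obtain ⟨hVp, hVu⟩ := mem_blocksIn.1 hV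
  rw [← prod_minWeight hVp, ← List.prod_toFinset _ hu, ← List.prod_toFinset _ (hu.filter _),
    ← Finset.prod_sdiff (s₁ := V) (s₂ := u.toFinset) fun i hi => List.mem_toFinset.2 (hVu i hi),
    mul_comm]
  congr 1
  refine Finset.prod_congr ?_ fun _ _ => rfl
  ext i
  simp

variable [CharZero K]

/-- Both sides have the same derivative and the same value at `0`. In the flow equation each block
of `π` contributes the product of the weights of its gaps, known by induction, and by
`forall_isBlockClosed_iff` only the minimal blocks of a closed word survive. -/
theorem expFlow_blockIndicator (hπ : IsNoncrossing π) {u : List (Fin n)}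
    (hu : u <:+: List.finRange n) [Decidable (IsBlockClosed π u)] :
    expFlow (blockIndicator K π) u =
      if IsBlockClosed π u then (u.map (minWeight K π)).prod else 0 := by
  classical
  induction hm : u.length using Nat.strong_induction_on generalizing u with
  | _ m ih =>
    by_cases hnil : u = []
    · subst hnil
      have hc : IsBlockClosed π [] := fun i hi => absurd hi List.not_mem_nil
      rw [if_pos hc, expFlow, treeSum_nil, expWeight_leaf]
      simp
    have hnodup : u.Nodup := (List.nodup_finRange n).sublist hu.sublist
    have hder : derivative (expFlow (blockIndicator K π) u) =
        if IsBlockClosed π u then ∑ V ∈ minimalBlocks (blocksIn π u),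
          ((u.filter fun x => !decide (x ∈ V)).map (minWeight K π)).prod else 0 := by
      have hind : (fun v => C (blockIndicator K π v)) = fun v =>
          ∑ V ∈ π.parts, if v = blockWord V then (1 : K[X]) else 0 := by
        funext v
        simp [blockIndicator]
      rw [derivative_expFlow blockIndicator_nil, hind, wordComp, compAux_sum_left]
      have hterm : ∀ V ∈ π.parts, compAux (expFlow (blockIndicator K π)) u
          (fun v => if v = blockWord V then 1 else 0) (expFlow (blockIndicator K π)) =
          if IsBlockClosed π u ∧ V ∈ minimalBlocks (blocksIn π u) then
            ((u.filter fun x => !decide (x ∈ V)).map (minWeight K π)).prod else 0 := by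
        intro V hV
        have hsub : (u.filter (· ∈ V)).Sublist (blockWord V) := hu.sublist.filter _
        have h := wordComp_single (fun x => decide (x ∈ V)) (expFlow (blockIndicator K π)) u
          (blockWord V) (by simp) hsub.length_le
        rw [wordComp] at h
        rw [h]
        by_cases hVu : V ∈ blocksIn π u
        · have hfilter : u.filter (· ∈ V) = blockWord V := by
            refine hsub.eq_of_length_le (List.Subperm.length_le ?_)
            refine List.subperm_of_subset ((List.nodup_finRange n).filter _) fun i hi => ?_
            have := (mem_blockWord.1 hi)
            simp [this, (mem_blocksIn.1 hVu).2 i this]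
          rw [if_pos hfilter]
          have hJ : ∀ J ∈ u.splitOnP (· ∈ V), expFlow (blockIndicator K π) J =
              if IsBlockClosed π J then (J.map (minWeight K π)).prod else 0 := by
            intro J hJ
            obtain ⟨hJV, pre, post, e, -⟩ := exists_of_mem_splitOnP hJ
            have hJu : J <:+: u := ⟨pre, post, e.symm⟩
            refine ih J.length ?_ (hJu.trans hu) rfl
            obtain ⟨v, hv⟩ := π.nonempty_of_mem_parts hV
            rw [← hm]
            refine lt_of_le_of_ne hJu.length_le fun hl => ?_
            have := hJu.sublist.eq_of_length hl
            exact hJV v (this ▸ (mem_blocksIn.1 hVu).2 v hv) (by simpa using hv)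
          rw [List.map_congr_left hJ, prod_map_ite_zero, prod_map_splitOnP]
          exact if_congr (forall_isBlockClosed_iff hπ hu hVu) rfl rfl
        · rw [if_neg, if_neg]
          · exact fun h => hVu (mem_minimalBlocks.1 h.2).1
          · refine fun h => hVu (mem_blocksIn.2 ⟨hV, fun i hi => ?_⟩)
            rw [← mem_blockWord, ← h] at hi
            exact (List.mem_filter.1 hi).1
      rw [Finset.sum_congr rfl hterm]
      by_cases hc : IsBlockClosed π u
      · simp only [hc, true_and, if_true]
        rw [← Finset.sum_filter]
        refine Finset.sum_congr ?_ fun _ _ => rfl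
        ext V
        simp only [Finset.mem_filter, and_iff_right_iff_imp]
        exact fun h => (mem_blocksIn.1 (mem_minimalBlocks.1 h).1).1
      · simp [hc]
    refine eq_of_derivative_eq_of_eval_zero_eq ?_ ?_
    · rw [hder]
      by_cases hc : IsBlockClosed π u
      · rw [if_pos hc, if_pos hc]
        have hD : blocksIn π u ⊆ π.parts := fun V hV => (mem_blocksIn.1 hV).1
        have hup : ∀ V ∈ blocksIn π u, ∀ W ∈ π.parts, Nests V W → W ∈ blocksIn π u := by
          intro V hV W hW hVW
          refine mem_blocksIn.2 ⟨hW, fun i hi => ?_⟩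
          obtain ⟨⟨x, hx, hxi⟩, y, hy, hiy⟩ := hVW i hi
          have h2 := (mem_blocksIn.1 hV).2
          exact mem_of_infix_of_between hu (h2 x hx) (h2 y hy) hxi hiy
        -- Euler's identity: the product is a monomial whose degree is the number of blocks in `u`.
        have hX : X * derivative (u.map (minWeight K π)).prod =
            C (#(blocksIn π u) : K) * (u.map (minWeight K π)).prod := by
          rw [prod_map_minWeight hnodup hc, Finset.prod_mul_distrib, Finset.prod_const, ← map_prod,
            derivative_C_mul, derivative_X_pow]
          rcases #(blocksIn π u) with _ | k
          · simp
          · simp only [Nat.add_sub_cancel, pow_succ]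
            ring
        refine mul_left_cancel₀ (X_ne_zero (R := K)) ?_
        -- The degree is split as the sum of the hook lengths of the minimal blocks; each summand
        -- cancels the denominator in the weight of its own block.
        rw [hX, ← sum_card_below hD hup hπ, Finset.mul_sum, Nat.cast_sum, map_sum, Finset.sum_mul]
        refine Finset.sum_congr rfl fun V hV => ?_
        have hVD := (mem_minimalBlocks.1 hV).1
        have hne : (#(below π V) : K) ≠ 0 :=
          Nat.cast_ne_zero.2 (Finset.card_pos.2 ⟨V, self_mem_below (hD hVD)⟩).ne'
        rw [← prod_map_filter_minWeight hnodup hVD, ← mul_assoc, ← mul_assoc, ← C_mul,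
          mul_inv_cancel₀ hne, C_1, one_mul]
      · simp [hc]
    · rw [eval_zero_expFlow, emptyWord]
      simp only [List.isEmpty_iff, hnil, if_false]
      split_ifs with hc
      · obtain ⟨i, hi⟩ := List.exists_mem_of_ne_nil u hnil
        have hmem : π.part i ∈ blocksIn π u :=
          mem_blocksIn.2 ⟨π.part_mem.2 (mem_univ i), hc i hi⟩
        rw [prod_map_minWeight hnodup hc, eval_prod, Finset.prod_eq_zero hmem]
        simp
      · simp

open Classical in
/-- The inverse factorials of the skeletons of the Schröder trees over `π` add up to the inverse
factorial of the forest of nestings of `π`. -/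
theorem sum_inv_factorial_skeleton (hn : n ≠ 0) (hπ : IsNoncrossing π) :
    ∑ t ∈ (ST n).filter (fun t => treePartition n t = π), (t.skeleton.factorial : K)⁻¹ =
      (nestingFactorial π : K)⁻¹ := by
  -- At time `1` on the full word, the left side keeps just the trees over `π` and the right side is
  -- the inverse product of hook lengths.
  have h := congrArg (eval 1) (expFlow_blockIndicator (K := K) hπ (List.infix_refl (List.finRange n)))
  have hc : IsBlockClosed π (List.finRange n) := fun _ _ _ _ => List.mem_finRange _
  have hne : List.finRange n ≠ [] := by simpa using hn
  rw [if_pos hc, prod_map_minWeight (List.nodup_finRange n) hc, eval_one_expFlow _ hne, eval_prod,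
    List.length_finRange] at h
  have hall : blocksIn π (List.finRange n) = π.parts := by
    ext V; simp [mem_blocksIn]
  rw [Finset.sum_filter, nestingFactorial_eq_prod hπ, Nat.cast_prod, ← Finset.prod_inv_distrib]
  simp only [hall, eval_mul, eval_C, eval_X, mul_one] at h
  rw [← h]
  refine Finset.sum_congr rfl fun t ht => ?_
  rw [treeEval_blockIndicator (mem_ST.1 ht).2]
  simp

end Fiber

/-! ### Strict maps from trees to chains -/

section StrictMaps

/-- Every map factors uniquely as a surjection onto its image followed by the increasing enumeration
of the image, and there are `N.choose k` images of size `k`. -/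
theorem card_strictMaps_eq_sum {α : Type*} [Finite α] (r : α → α → Prop) (N : ℕ) :
    Nat.card {f : α → Fin N // ∀ v w, r v w → f v < f w} =
      ∑ k ∈ range (N + 1), N.choose k *
        Nat.card {f : α → Fin k // Function.Surjective f ∧ ∀ v w, r v w → f v < f w} := by
  classical
  have := Fintype.ofFinite α
  let e : (Σ I : Finset (Fin N),
      {g : α → Fin #I // Function.Surjective g ∧ ∀ v w, r v w → g v < g w}) →
      {f : α → Fin N // ∀ v w, r v w → f v < f w} :=
    fun p => ⟨fun v => p.1.orderEmbOfFin rfl (p.2.1 v), fun v w h =>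
      (p.1.orderEmbOfFin rfl).lt_iff_lt.2 (p.2.2.2 v w h)⟩
  have hrange : ∀ p, Set.range (e p).1 = p.1 := by
    intro p
    have : (e p).1 = p.1.orderEmbOfFin rfl ∘ p.2.1 := rfl
    rw [this, p.2.2.1.range_comp, Finset.range_orderEmbOfFin]
  have he : Function.Bijective e := by
    constructor
    · rintro ⟨I, g⟩ ⟨I', g'⟩ h
      have hI : I = I' := by
        have h1 := hrange ⟨I, g⟩
        rw [h, hrange] at h1
        exact (Finset.coe_injective h1).symm
      subst hI
      refine congrArg (Sigma.mk I) (Subtype.ext (funext fun v => ?_))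
      exact (I.orderEmbOfFin rfl).injective (congrFun (congrArg Subtype.val h) v)
    · rintro ⟨f, hf⟩
      have hmem : ∀ v, f v ∈ univ.image f := fun v => mem_image_of_mem f (mem_univ v)
      refine ⟨⟨univ.image f, fun v => ((univ.image f).orderIsoOfFin rfl).symm ⟨f v, hmem v⟩, ?_, ?_⟩,
        ?_⟩
      · intro k
        obtain ⟨v, -, hv⟩ := Finset.mem_image.1 (((univ.image f).orderIsoOfFin rfl) k).2
        refine ⟨v, ?_⟩
        rw [OrderIso.symm_apply_eq]
        exact Subtype.ext hv
      · intro v w h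
        rw [OrderIso.lt_iff_lt]
        exact hf v w h
      · refine Subtype.ext (funext fun v => ?_)
        change (univ.image f).orderEmbOfFin rfl _ = _
        rw [← Finset.coe_orderIsoOfFin_apply, OrderIso.apply_symm_apply]
  rw [← Nat.card_congr (Equiv.ofBijective e he), Nat.card_sigma]
  have h := Finset.sum_powerset_apply_card (x := (univ : Finset (Fin N))) fun k => Nat.card
    {f : α → Fin k // Function.Surjective f ∧ ∀ v w, r v w → f v < f w}
  rw [Finset.powerset_univ, Finset.card_univ, Fintype.card_fin] at h
  simpa using h

/-! ### Counting strict maps on a planar tree -/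

namespace PlanarTree

/-- The number of maps `f` from the vertices of `t` to a chain with `N` elements such that
`f v < f w` whenever `v < w`. -/
noncomputable def strictCount (t : PlanarTree) (N : ℕ) : ℕ :=
  Nat.card {f : t.vertices → Fin N // ∀ v w : t.vertices, (v.1 <+: w.1 ∧ v ≠ w) → f v < f w}

theorem nil_mem_vertices (t : PlanarTree) : [] ∈ t.vertices := by
  cases t with
  | node ts => simp [vertices, vertexList]

theorem cons_mem_vertices {ts : List PlanarTree} {i : ℕ} {l : List ℕ} :
    i :: l ∈ (node ts).vertices ↔ ∃ h : i < ts.length, l ∈ (ts[i]).vertices := by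
  simp only [vertices, List.mem_toFinset]
  rw [vertexList]
  simp only [List.mem_cons, List.cons_ne_nil, false_or, List.mem_flatten, List.mem_mapIdx,
    List.length_map, List.getElem_map]
  constructor
  · rintro ⟨_, ⟨j, hj, rfl⟩, h⟩
    simp only [List.mem_map, List.cons.injEq] at h
    obtain ⟨l', hl', rfl, rfl⟩ := h
    exact ⟨hj, hl'⟩
  · rintro ⟨h, hl⟩
    exact ⟨_, ⟨i, h, rfl⟩, List.mem_map_of_mem hl⟩

theorem length_vertexList (t : PlanarTree) : t.vertexList.length = t.size := by
  induction t using PlanarTree.induction with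
  | h ts ih =>
    have key : ∀ f : ℕ → ℕ, (((ts.map vertexList).mapIdx
        fun i l => l.map (f i :: ·)).flatten).length = (ts.map size).sum := by
      induction ts with
      | nil => simp
      | cons t ts iht =>
        intro f
        have h1 := iht (fun t ht => ih t (List.mem_cons_of_mem _ ht)) (fun i => f (i + 1))
        have h2 := ih t (by simp)
        simp only [List.map_cons, List.mapIdx_cons, List.flatten_cons, List.length_append,
          List.length_map, List.sum_cons, h1, h2]
    rw [vertexList, size, List.length_cons, add_comm]
    exact congrArg (1 + ·) (key id)

theorem omegaCount_eq_zero {t : PlanarTree} {k : ℕ} (hk : k ∉ Finset.Icc 1 t.size) :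
    t.omegaCount k = 0 := by
  refine Nat.card_eq_zero.2 (Or.inl ⟨fun f => hk ?_⟩)
  obtain ⟨f, hf, -⟩ := f
  rw [Finset.mem_Icc]
  constructor
  · exact Fin.pos (f ⟨[], t.nil_mem_vertices⟩)
  · have h := Fintype.card_le_of_surjective f hf
    rw [Fintype.card_fin, Fintype.card_coe] at h
    exact h.trans ((List.toFinset_card_le _).trans t.length_vertexList.le)

theorem strictCount_eq_sum (t : PlanarTree) (N : ℕ) :
    t.strictCount N = ∑ k ∈ Finset.Icc 1 t.size, N.choose k * t.omegaCount k := by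
  have h := card_strictMaps_eq_sum (fun v w : t.vertices => v.1 <+: w.1 ∧ v ≠ w) N
  have h2 : ∀ k, Nat.card {f : t.vertices → Fin k // Function.Surjective f ∧
      ∀ v w : t.vertices, (v.1 <+: w.1 ∧ v ≠ w) → f v < f w} = t.omegaCount k := fun k =>
    Nat.card_congr (Equiv.subtypeEquivRight fun f => by simp only [and_imp])
  simp only [h2] at h
  rw [strictCount, h]
  have h3 : ∀ s : Finset ℕ, Finset.Icc 1 t.size ⊆ s → ∑ k ∈ Finset.Icc 1 t.size,
      N.choose k * t.omegaCount k = ∑ k ∈ s, N.choose k * t.omegaCount k := fun s hs =>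
    Finset.sum_subset hs fun k _ hk => by rw [omegaCount_eq_zero hk, mul_zero]
  -- Both index sets are enlarged to a common range: the binomial coefficients vanish beyond `N`,
  -- the surjection counts outside `1, …, |t|`.
  rw [h3 (range (N + t.size + 1)) fun k hk => by
    rw [Finset.mem_Icc] at hk; rw [Finset.mem_range]; omega]
  refine Finset.sum_subset (fun k hk => ?_) fun k _ hk => ?_
  · rw [Finset.mem_range] at hk ⊢; omega
  · rw [Nat.choose_eq_zero_of_lt, zero_mul]
    rw [Finset.mem_range] at hk; omega

theorem strictCount_zero (t : PlanarTree) : t.strictCount 0 = 0 :=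
  Nat.card_eq_zero.2 (Or.inl ⟨fun f => (f.1 ⟨[], t.nil_mem_vertices⟩).elim0⟩)

/-- If the root is not sent to `0`, no vertex is, and shifting down gives a strict map to an
`N`-chain (`e₁`). If it is, the subtrees map independently to the `N` remaining values (`e₂`). -/
theorem strictCount_node_succ (ts : List PlanarTree) (N : ℕ) :
    (node ts).strictCount (N + 1) =
      (node ts).strictCount N + (ts.map fun t => t.strictCount N).prod := by
  let S (t : PlanarTree) (N : ℕ) : Type :=
    {f : t.vertices → Fin N // ∀ v w : t.vertices, (v.1 <+: w.1 ∧ v ≠ w) → f v < f w}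
  let e₁ : S (node ts) N → S (node ts) (N + 1) := fun g =>
    ⟨fun v => (g.1 v).succ, fun v w h => Fin.succ_lt_succ_iff.2 (g.2 v w h)⟩
  let F (g : ∀ i : Fin ts.length, S ts[i] N) : (node ts).vertices → Fin (N + 1)
    | ⟨[], _⟩ => 0
    | ⟨i :: l, h⟩ => ((g ⟨i, (cons_mem_vertices.1 h).1⟩).1 ⟨l, (cons_mem_vertices.1 h).2⟩).succ
  have hF : ∀ g, ∀ v w : (node ts).vertices, (v.1 <+: w.1 ∧ v ≠ w) → F g v < F g w := by
    rintro g ⟨v, hv⟩ ⟨w, hw⟩ ⟨hvw, hne⟩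
    match v, w, hv, hw, hvw, hne with
    | [], [], _, _, _, hne => exact absurd rfl hne
    | [], j :: l, _, _, _, _ => exact Fin.succ_pos _
    | i :: l, [], _, _, hvw, _ => simp at hvw
    | i :: l, j :: l', hv, hw, hvw, hne =>
      obtain ⟨rfl, hl⟩ := List.cons_prefix_cons.1 hvw
      refine Fin.succ_lt_succ_iff.2 ((g ⟨i, _⟩).2 _ _ ⟨hl, fun h => hne ?_⟩)
      have := congrArg Subtype.val h
      exact Subtype.ext (by simpa using this)
  let e₂ : (∀ i : Fin ts.length, S ts[i] N) → S (node ts) (N + 1) := fun g => ⟨F g, hF g⟩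
  let root : (node ts).vertices := ⟨[], nil_mem_vertices _⟩
  have hroot : ∀ f : S (node ts) (N + 1), ∀ v, v ≠ root → f.1 root < f.1 v := fun f v hv =>
    f.2 root v ⟨List.nil_prefix, hv.symm⟩
  have he : Function.Bijective (Sum.elim e₁ e₂) := by
    constructor
    · refine Function.Injective.sumElim ?_ ?_ ?_
      · intro g g' h
        refine Subtype.ext (funext fun v => ?_)
        exact Fin.succ_injective _ (congrFun (congrArg Subtype.val h) v)
      · intro g g' h
        funext i
        refine Subtype.ext (funext fun v => ?_)
        exact Fin.succ_injective _ (congrFun (congrArg Subtype.val h)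
          ⟨i :: v.1, cons_mem_vertices.2 ⟨i.2, v.2⟩⟩)
      · intro g g' h
        have h1 : (e₁ g).1 root = (e₂ g').1 root := by rw [h]
        exact Fin.succ_ne_zero _ h1
    · intro f
      by_cases h0 : f.1 root = 0
      · have hne : ∀ (i : Fin ts.length) (v : ts[i].vertices),
            f.1 ⟨i :: v.1, cons_mem_vertices.2 ⟨i.2, v.2⟩⟩ ≠ 0 := by
          intro i v
          have := hroot f ⟨i :: v.1, cons_mem_vertices.2 ⟨i.2, v.2⟩⟩
            fun h => by simpa using congrArg Subtype.val h
          exact (Fin.pos_of_ne_zero (Fin.ne_zero_of_lt this)).ne'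
        refine ⟨Sum.inr fun i => ⟨fun v => (f.1 _).pred (hne i v), ?_⟩, ?_⟩
        · rintro v w ⟨h1, h2⟩
          rw [Fin.pred_lt_pred_iff]
          refine f.2 _ _ ⟨List.cons_prefix_cons.2 ⟨rfl, h1⟩, fun h => h2 ?_⟩
          exact Subtype.ext (by simpa using congrArg Subtype.val h)
        · refine Subtype.ext (funext fun v => ?_)
          obtain ⟨v, hv⟩ := v
          match v, hv with
          | [], _ => exact h0.symm
          | i :: l, hv =>
            exact Fin.succ_pred _ (hne ⟨i, (cons_mem_vertices.1 hv).1⟩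
              ⟨l, (cons_mem_vertices.1 hv).2⟩)
      · have hne : ∀ v, f.1 v ≠ 0 := by
          intro v
          by_cases hv : v = root
          · rwa [hv]
          · exact Fin.ne_zero_of_lt (hroot f v hv)
        refine ⟨Sum.inl ⟨fun v => (f.1 v).pred (hne v), ?_⟩, ?_⟩
        · intro v w h
          rw [Fin.pred_lt_pred_iff]
          exact f.2 v w h
        · exact Subtype.ext (funext fun v => Fin.succ_pred _ (hne v))
  have hfin : ∀ t N, Finite (S t N) := fun t N => Subtype.finite
  have h := Nat.card_congr (Equiv.ofBijective _ he)
  rw [Nat.card_sum, Nat.card_pi] at h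
  rw [strictCount, ← h]
  congr 1
  rw [← Fin.prod_univ_fun_getElem]
  rfl

end PlanarTree

end StrictMaps

/-! ### The order polynomial -/

section OrderPolynomial

open Polynomial PlanarTree

variable (K : Type*) [Field K]

/-- The number of strict maps from the skeleton of a tree (empty for a leaf). -/
noncomputable def strictWeight (N : ℕ) (t : PlanarTree) : K :=
  if t.children.isEmpty then 1 else (t.skeleton.strictCount N : K)

variable {K}

theorem strictWeight_succ {ts : List PlanarTree} (hts : ts ≠ []) (N : ℕ) :
    strictWeight K (N + 1) (.node ts) - strictWeight K N (.node ts) =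
      (ts.map (strictWeight K N)).prod := by
  have key : (ts.map (strictWeight K N)).prod = ((((ts.filter fun s => !s.children.isEmpty).map
      skeleton).map fun t => t.strictCount N).prod : ℕ) := by
    clear hts
    induction ts with
    | nil => simp
    | cons t ts ih =>
      rw [List.map_cons, List.prod_cons, ih, strictWeight]
      cases h : t.children.isEmpty with
      | true => simp [h]
      | false => simp [h]
  rw [key, strictWeight, strictWeight]
  have hch : (node ts).children.isEmpty = false := by simpa [children] using hts
  rw [hch, if_neg Bool.false_ne_true, if_neg Bool.false_ne_true, skeleton, strictCount_node_succ,
    Nat.cast_add, add_sub_cancel_left]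

variable {A : Type*}

theorem children_ne_nil_of_mem_ST {n : ℕ} (hn : n ≠ 0) {t : PlanarTree} (ht : t ∈ ST n) :
    t.children ≠ [] := by
  obtain ⟨-, h2⟩ := mem_ST.1 ht
  cases t with
  | node ts =>
    rintro h
    simp only [children] at h
    subst h
    simp only [numLeaves, List.isEmpty_nil, if_true] at h2
    omega

/-- With the increments as `d` in `treeSum_add_mul`, the term with `f [] = 1` restores the sum for
`N`. Starting from the unit at `N = 0`, these sums are therefore the composition powers of `f`. -/
theorem treeSum_strictWeight_succ {f : List A → K} (hf : f [] = 1) (N : ℕ) :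
    treeSum (strictWeight K (N + 1)) f = wordComp f (treeSum (strictWeight K N) f) := by
  funext w
  by_cases hw : w = []
  · subst hw
    simp [treeSum_nil, wordComp, compAux, hf, strictWeight, children]
  · have h := treeSum_add_mul (strictWeight K N)
      (fun t => strictWeight K (N + 1) t - strictWeight K N t)
      (fun ts hts => strictWeight_succ (by rintro rfl; simp at hts) N) f hw
    rw [← h, hf, one_mul, treeSum, treeSum, treeSum, ← Finset.sum_add_distrib]
    exact Finset.sum_congr rfl fun t _ => by ring

theorem treeSum_strictWeight_zero (f : List A → K) :
    treeSum (strictWeight K 0) f = emptyWord := by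
  funext w
  by_cases hw : w = []
  · subst hw
    simp [treeSum_nil, strictWeight, children, emptyWord]
  · have hn : w.length ≠ 0 := by simpa using hw
    simp only [emptyWord, List.isEmpty_iff, hw, if_false]
    refine Finset.sum_eq_zero fun t ht => ?_
    simp [strictWeight, children_ne_nil_of_mem_ST hn ht, strictCount_zero]

variable (K) [CharZero K]

/-- The polynomial whose value at `N` is the binomial coefficient `N.choose k`. -/
noncomputable def choosePoly (k : ℕ) : K[X] := C ((k.factorial : K)⁻¹) * descPochhammer K k

theorem eval_choosePoly (k N : ℕ) : (choosePoly K k).eval (N : K) = N.choose k := by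
  have h : (k.factorial : K) ≠ 0 := Nat.cast_ne_zero.2 k.factorial_ne_zero
  rw [choosePoly, eval_mul, eval_C, descPochhammer_eval_eq_descFactorial,
    Nat.descFactorial_eq_factorial_mul_choose, Nat.cast_mul, inv_mul_cancel_left₀ h]

theorem coeff_one_choosePoly {k : ℕ} (hk : 1 ≤ k) :
    (choosePoly K k).coeff 1 = (-1) ^ (k + 1) / (k : K) := by
  obtain ⟨m, rfl⟩ : ∃ m, k = m + 1 := ⟨k - 1, by omega⟩
  -- Dividing the falling factorial of length `m + 1` by `X` and setting `X = 0` leaves the falling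
  -- factorial of length `m` at `-1`.
  have h1 : ∀ m : ℕ, (descPochhammer K m).eval (-1) = (-1) ^ m * (m.factorial : K) := by
    intro m
    induction m with
    | zero => simp
    | succ m ih =>
      rw [descPochhammer_succ_eval, ih, Nat.factorial_succ]
      push_cast
      ring
  have h2 : (m.factorial : K) ≠ 0 := Nat.cast_ne_zero.2 m.factorial_ne_zero
  have h3 : ((m : K) + 1) ≠ 0 := Nat.cast_add_one_ne_zero m
  rw [choosePoly, coeff_C_mul, descPochhammer_succ_left, coeff_X_mul, coeff_zero_eq_eval_zero,
    eval_comp]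
  simp only [eval_sub, eval_X, eval_one, zero_sub, h1, Nat.factorial_succ]
  push_cast
  field_simp
  ring

/-- The polynomial whose value at `N` is the number of strict maps to a chain with `N`
elements. -/
noncomputable def orderPoly (t : PlanarTree) : K[X] :=
  ∑ k ∈ Finset.Icc 1 t.size, C (t.omegaCount k : K) * choosePoly K k

theorem eval_orderPoly (t : PlanarTree) (N : ℕ) :
    (orderPoly K t).eval (N : K) = t.strictCount N := by
  rw [orderPoly, eval_finsetSum, strictCount_eq_sum, Nat.cast_sum]
  refine Finset.sum_congr rfl fun k _ => ?_
  rw [eval_mul, eval_C, eval_choosePoly, Nat.cast_mul, mul_comm]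

theorem coeff_one_orderPoly (t : PlanarTree) : (orderPoly K t).coeff 1 = (t.murua : K) := by
  rw [orderPoly, finsetSum_coeff, murua, Rat.cast_sum]
  refine Finset.sum_congr rfl fun k hk => ?_
  rw [coeff_C_mul, coeff_one_choosePoly K (Finset.mem_Icc.1 hk).1]
  push_cast
  ring

variable {K}

/-- If `f` is the exponential of `ρ`, then `ρ` is the logarithm of `f`, which is given by the Murua
coefficients of the skeletons. -/
theorem eq_sum_murua {ρ f : List A → K} (hρ : ρ [] = 0) (hf : ∀ w, (expFlow ρ w).eval 1 = f w)
    {w : List A} (hw : w ≠ []) :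
    ρ w = ∑ t ∈ ST w.length, (t.skeleton.murua : K) * treeEval f t w := by
  have hn : w.length ≠ 0 := by simpa using hw
  have hf1 : f [] = 1 := by
    rw [← hf, expFlow, treeSum_nil, expWeight_leaf, eval_one]
  -- Both sides are the `N`-fold composition power of `f`, the right one by the semigroup property.
  have hN : ∀ N : ℕ, treeSum (strictWeight K N) f = fun v => (expFlow ρ v).eval (N : K) := by
    intro N
    induction N with
    | zero =>
      rw [treeSum_strictWeight_zero]
      funext v
      rw [Nat.cast_zero, eval_zero_expFlow]
    | succ N ih =>
      rw [treeSum_strictWeight_succ hf1, ih]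
      funext v
      have h := flow_semigroup hρ (derivative_expFlow hρ) (eval_zero_expFlow ρ) 1 (N : K) v
      simp only [hf] at h
      rw [Nat.cast_succ, add_comm, h]
  -- Two polynomials with equal values at all natural numbers coincide; the claim follows by
  -- comparing their linear coefficients.
  have hpoly : ∑ t ∈ ST w.length, C (treeEval f t w) * orderPoly K t.skeleton = expFlow ρ w := by
    refine eq_of_infinite_eval_eq _ _ (Set.infinite_of_injective_forall_mem
      (f := fun N : ℕ => (N : K)) Nat.cast_injective fun N => ?_)
    have h := congrFun (hN N) w
    rw [Set.mem_ofPred_eq, ← h, treeSum, eval_finsetSum]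
    refine Finset.sum_congr rfl fun t ht => ?_
    rw [eval_mul, eval_C, eval_orderPoly, mul_comm, strictWeight]
    simp [children_ne_nil_of_mem_ST hn ht]
  rw [← coeff_one_expFlow hρ w, ← hpoly, finsetSum_coeff]
  refine Finset.sum_congr rfl fun t _ => ?_
  rw [coeff_C_mul, coeff_one_orderPoly, mul_comm]

end OrderPolynomial

/-! ### Grouping Schröder trees by their partition -/

section Main

variable {A : Type*}

theorem partitionEval_treePartition {n : ℕ} {t : PlanarTree} (ht : t ∈ ST n)
    (F : (m : ℕ) → (Fin m → A) → ℂ) {f : List A → ℂ} (hf : ∀ w, w ≠ [] → f w = toWord F w)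
    (a : Fin n → A) :
    partitionEval F (treePartition n t) a = treeEval f t (List.ofFn a) := by
  rw [← prod_treePartition (mem_ST.1 ht).2, partitionEval_eq_prod]
  refine Finset.prod_congr rfl fun V hV => (hf _ ?_).symm
  obtain ⟨i, hi⟩ := (treePartition n t).nonempty_of_mem_parts hV
  exact List.ne_nil_of_mem (List.mem_map_of_mem (mem_blockWord.2 hi))

/-- Serves twice: with inverse skeleton factorials and the cumulants, and with Murua coefficients
and the moments. Agreement of `f` with `F` on nonempty words suffices, as blocks are nonempty. -/
theorem sum_NC_fiberwise {n : ℕ} (c : PlanarTree → ℂ) (F : (m : ℕ) → (Fin m → A) → ℂ)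
    {f : List A → ℂ} (hf : ∀ w, w ≠ [] → f w = toWord F w) (a : Fin n → A)
    [DecidableEq (SetPartition n)] :
    ∑ π ∈ NC n, (∑ t ∈ (ST n).filter (fun t => treePartition n t = π), c t) *
      partitionEval F π a = ∑ t ∈ ST n, c t * treeEval f t (List.ofFn a) := by
  rw [← Finset.sum_fiberwise_of_maps_to (s := ST n) (t := NC n) (g := treePartition n)
    fun t ht => treePartition_mem_NC (mem_ST.1 ht).2]
  refine Finset.sum_congr rfl fun π _ => ?_
  rw [Finset.sum_mul]
  refine Finset.sum_congr rfl fun t ht => ?_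
  obtain ⟨h1, h2⟩ := Finset.mem_filter.1 ht
  rw [← h2, partitionEval_treePartition h1 F hf]

end Main

end NCProb
theorem corollary5p4 {A : Type*} [Ring A] [Algebra ℂ A] (φ : A →ₗ[ℂ] ℂ) (hφ : φ 1 = 1)
    (h : (n : ℕ) → MultilinearMap ℂ (fun _ : Fin n => A) ℂ)
    (hh : NCProb.IsMonotoneCumulants φ h)
    (n : ℕ) (hn : 1 ≤ n) (a : Fin n → A) :
    h n a = ∑ π ∈ NCProb.NC n,
      (NCProb.alpha π : ℂ) * NCProb.partitionEval (NCProb.moment φ) π a := by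
  classical
  -- `h 0` is arbitrary, whereas the flow needs a generator that vanishes at the empty word.
  let ρ : List A → ℂ := fun w => if w = [] then 0 else NCProb.toWord (fun m => ⇑(h m)) w
  have hρ : ∀ w, w ≠ [] → ρ w = NCProb.toWord (fun m => ⇑(h m)) w := fun w hw => if_neg hw
  have hρ0 : ρ [] = 0 := if_pos rfl
  have hmom : ∀ w : List A, φ w.prod = NCProb.toWord (NCProb.moment φ) w := fun w => by
    rw [NCProb.toWord, NCProb.moment]
    simp
  -- The defining relation of the cumulants, with `1 / t(π)!` expanded over the Schröder trees above
  -- `π`; at the empty word it is `φ 1 = 1`.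
  have hexp : ∀ w, (NCProb.expFlow ρ w).eval 1 = φ w.prod := by
    intro w
    by_cases hw : w = []
    · subst hw
      simp [NCProb.expFlow, NCProb.treeSum_nil, NCProb.expWeight_leaf, hφ]
    · have hw1 : 1 ≤ w.length := List.length_pos_iff.2 hw
      have hs := NCProb.sum_NC_fiberwise (n := w.length)
        (fun t => (t.skeleton.factorial : ℂ)⁻¹) (fun m => ⇑(h m)) hρ w.get
      rw [List.ofFn_get] at hs
      rw [NCProb.eval_one_expFlow ρ hw, hmom, NCProb.toWord, hh w.length hw1, ← hs]
      refine Finset.sum_congr rfl fun π hπ => ?_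
      have hnc : NCProb.IsNoncrossing π := by simpa [NCProb.NC] using hπ
      rw [one_div, ← NCProb.sum_inv_factorial_skeleton (K := ℂ) (by omega) hnc]
  have hne : List.ofFn a ≠ [] := by simp; omega
  have hmain := NCProb.eq_sum_murua hρ0 hexp hne
  rw [hρ _ hne, NCProb.toWord_ofFn, List.length_ofFn] at hmain
  rw [hmain, ← NCProb.sum_NC_fiberwise _ (NCProb.moment φ) (fun w _ => hmom w) a]
  refine Finset.sum_congr rfl fun π _ => ?_
  rw [NCProb.alpha, Rat.cast_sum]
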